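/- **Setting.** For each $n$ the observed data $y_{1:n}\in\mathbb R^n$ have law $P^{(n)}_0$; $S_n:\mathbb R^n\to\mathbb R^d$ is a measurable summary statistic, and $S_n$ also denotes $S_n(y_{1:n})$. The assumed model is a measurable family of probability laws $P^{(n)}_\theta$, $\theta\in\Theta\subset\mathbb R^{d_\theta}$, under which $S_n(z)$, $z\sim P_\theta^{(n)}$, has finite second moments, mean $b_n(\theta)$ and covariance matrix $\Sigma_n(\theta)$. The prior has a density $\pi$ on $\Theta$ with respect to Lebesgue measure. Let $N(x;\mu,A)$ be the normal density (set to $0$ if $A$ is singular), $g_n(s\mid\theta)=N\{s;b_n(\theta),\Sigma_n(\theta)\}$ the exact synthetic likelihood, and $\overline g_n(s\mid\theta)=\mathbb E\,N\{s;\overline b_n(\theta),\overline\Sigma_n(\theta)\}$ the estimated one, where $\overline b_n(\theta),\overline\Sigma_n(\theta)$ are the sample mean and (unbiased) sample covariance matrix of $m=m(n)$ independent copies of $S_n(z)$, $z\sim P^{(n)}_\theta$. The BSL posterior density is $\overline\pi(\theta\mid S_n)=\pi(\theta)\overline g_n(S_n\mid\theta)/\int_\Theta\pi(\vartheta)\overline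 g_n(S_n\mid\vartheta)\,d\vartheta$ on $\Theta$, and $\overline\theta_n$ is its mean. Put $M_n(\theta)=n^{-1}\partial_\theta\ln g_n(S_n\mid\theta)$ and $H_n(\theta)=n^{-1}\partial^2_{\theta\theta^\top}\ln g_n(S_n\mid\theta)$. All probabilities, $o_p$, $O_p$ and limits are under $P^{(n)}_0$ as $n\to\infty$. **Assumptions.** 1. $m(n)\to\infty$; $\Theta$ is compact; for all large $n$ and every $s\in\mathbb R^d$ the map $\theta\mapsto\ln g_n(s\mid\theta)$ is $C^2$ on $\mathrm{Int}(\Theta)$. There is a function $b$, continuous on $\Theta$, with $b_n\to b$ uniformly on $\Theta$ (for instance $b_n=b$ for all $n$). 2. $S_n\to b_0$ in probability and $\sqrt n(S_n-b_0)\Rightarrow N(0,V)$ for some $b_0\in\mathbb R^d$ and some covariance matrix $V$. 3. For every $\theta\in\mathrm{Int}(\Theta)$ the limits in probability $M(\theta)=\operatorname{plim}M_n(\theta)$ and $H(\theta)=\operatorname{plim}H_n(\theta)$ exist; $\Theta_\star:=\{\theta\in\mathrm{Int}(\Theta):M(\theta)=0\}=\{\theta_\star\}$ is a singleton, $b$ is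 differentiable at $\theta_\star$, and $-H(\theta_\star)$ is positive definite. Every maximizer over $\Theta$ of the limit criterion $Q(\theta)=-\tfrac12\{b(\theta)-b_0\}^\top\Sigma(\theta)^{-1}\{b(\theta)-b_0\}$ (with $\Sigma$ as in 5) belongs to $\Theta_\star$. 4. For some $\delta>0$ there are $K_n=O_p(1)$ such that, with $P_0^{(n)}$-probability tending to one, $|H_n(\theta)_{ij}-H_n(\theta_\star)_{ij}|\le K_n\|\theta-\theta_\star\|$ for all $i,j$ and all $\theta\in\mathrm{Int}(\Theta)$ with $\|\theta-\theta_\star\|\le\delta$. 5. $\sup_{\theta\in\Theta}\|n\Sigma_n(\theta)-\Sigma(\theta)\|\to0$ for a matrix function $\Sigma$ that is continuous and positive definite on $\Theta$. 6. $\pi(\theta_\star)>0$, and $\pi$ is continuous on a neighbourhood of $\theta_\star$ in $\Theta$. 7. $\overline g_n(S_n\mid\theta)=g_n(S_n\mid\theta)\{1+\rho_n(\theta)\}$ for $\theta\in\Theta$, with $\sup_{\theta\in\Theta}|\rho_n(\theta)|=o_p(1)$ (for instance $O_p(1/m)$). 8. $\sqrt n\,M_n(\theta_\star)\Rightarrow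 N(0,W_\star)$, where $W_\star=\nabla b(\theta_\star)^\top\Sigma^{-1}(\theta_\star)V\Sigma^{-1}(\theta_\star)\nabla b(\theta_\star)$. Let $\Delta=\{-H(\theta_\star)\}^{-1}$. **Conclusion.** Under $P^{(n)}_0$, $$\sqrt n\,(\overline\theta_n-\theta_\star)\Rightarrow N(0,\Delta W_\star\Delta^\top),$$ whereas the posterior covariance matrix satisfies $n\,\mathrm{Cov}_{\overline\pi(\cdot\mid S_n)}(\theta)\to\Delta$ in probability. Consequently, for $a\in\mathbb R^{d_\theta}$ and $z>0$, the credible set $$C_n(a,z)=\bigl\{\theta:\ |a^\top(\theta-\overline\theta_n)|\le z\,\{a^\top\mathrm{Cov}_{\overline\pi(\cdot\mid S_n)}(\theta)\,a\}^{1/2}\bigr\}$$ has posterior probability converging in probability to $\Pr\{|\xi|\le z(a^\top\Delta a)^{1/2}\}$, $\xi\sim N(0,a^\top\Delta a)$, and frequentist coverage $P_0^{(n)}\{\theta_\star\in C_n(a,z)\}$ converging to $\Pr\{|\zeta|\le z(a^\top\Delta a)^{1/2}\}$, $\zeta\sim N(0,a^\top\Delta W_\star\Delta^\top a)$. If $\Delta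 W_\star\Delta^\top\ne\Delta$, there is an $a$ such that these two limits differ for every $z>0$, so that credible sets are not asymptotically valid. -/

import Mathlib

open MeasureTheory ProbabilityTheory Filter Set
open scoped Topology Matrix

namespace BSL

noncomputable section

/-- The Bayesian synthetic likelihood experiment: observed data `y ∈ ℝⁿ` with true law `P₀ n`, an
assumed parametric model `P n θ` for data in `ℝⁿ` (only `θ ∈ Θ` matters), `d`-dimensional
summaries `S n` with finite second moments under the model, and a prior density on `Θ ⊆ ℝᵖ`. -/
structure Experiment (p d : ℕ) where
  Θ : Set (EuclideanSpace ℝ (Fin p))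
  S : (n : ℕ) → (Fin n → ℝ) → EuclideanSpace ℝ (Fin d)
  measurable_S : ∀ n, Measurable (S n)
  P₀ : (n : ℕ) → Measure (Fin n → ℝ)
  isProb : ∀ n, IsProbabilityMeasure (P₀ n)
  P : (n : ℕ) → Kernel (EuclideanSpace ℝ (Fin p)) (Fin n → ℝ)
  isMarkov : ∀ n, IsMarkovKernel (P n)
  memLp_S : ∀ n, ∀ θ ∈ Θ, MemLp (S n) 2 (P n θ)
  prior : EuclideanSpace ℝ (Fin p) → ℝ
  measurable_prior : Measurable prior
  prior_nonneg : ∀ θ ∈ Θ, 0 ≤ prior θ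
  integral_prior : ∫ θ in Θ, prior θ = 1

attribute [instance] Experiment.isProb Experiment.isMarkov

/-- The density `N(x; μ, A)`; it is `0` when `A` is a singular covariance matrix. -/
def normalDensity {d : ℕ} (x μ : EuclideanSpace ℝ (Fin d)) (A : Matrix (Fin d) (Fin d) ℝ) : ℝ :=
  (Real.sqrt ((2 * Real.pi) ^ d * A.det))⁻¹ *
    Real.exp (-(1 / 2) * ((x - μ).ofLp ⬝ᵥ A⁻¹ *ᵥ (x - μ).ofLp))

def sampleMean {d m : ℕ} (s : Fin m → EuclideanSpace ℝ (Fin d)) : EuclideanSpace ℝ (Fin d) :=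
  (m : ℝ)⁻¹ • ∑ k, s k

def sampleCov {d m : ℕ} (s : Fin m → EuclideanSpace ℝ (Fin d)) : Matrix (Fin d) (Fin d) ℝ :=
  Matrix.of fun i j =>
    ((m : ℝ) - 1)⁻¹ * ∑ k, (s k i - sampleMean s i) * (s k j - sampleMean s j)

/-- `X n → c` in probability, where `X n` lives on the probability space `(Ω n, μ n)`. -/
def TendstoInProb {Ω : ℕ → Type*} [∀ n, MeasurableSpace (Ω n)] {E : Type*} [PseudoMetricSpace E]
    (μ : (n : ℕ) → Measure (Ω n)) (X : (n : ℕ) → Ω n → E) (c : E) : Prop :=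
  ∀ ε : ℝ, 0 < ε → Tendsto (fun n => μ n {ω | ε ≤ dist (X n ω) c}) atTop (𝓝 0)

/-- The Jacobian matrix `∇b(θ)`, of size `d × p`. -/
def jacobian {p d : ℕ} (b : EuclideanSpace ℝ (Fin p) → EuclideanSpace ℝ (Fin d))
    (θ : EuclideanSpace ℝ (Fin p)) : Matrix (Fin d) (Fin p) ℝ :=
  Matrix.of fun i j => fderiv ℝ b θ (EuclideanSpace.single j 1) i

/-- `W⋆ = ∇b(θ)ᵀ Σ(θ)⁻¹ V Σ(θ)⁻¹ ∇b(θ)`. -/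
def scoreCov {p d : ℕ} (b : EuclideanSpace ℝ (Fin p) → EuclideanSpace ℝ (Fin d))
    (Sig : EuclideanSpace ℝ (Fin p) → Matrix (Fin d) (Fin d) ℝ) (V : Matrix (Fin d) (Fin d) ℝ)
    (θ : EuclideanSpace ℝ (Fin p)) : Matrix (Fin p) (Fin p) ℝ :=
  (jacobian b θ)ᵀ * (Sig θ)⁻¹ * V * (Sig θ)⁻¹ * jacobian b θ

/-- The limit `-(1/2) (b(θ) - b₀)ᵀ Σ(θ)⁻¹ (b(θ) - b₀)` of the normalized log synthetic
likelihood. -/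
def limitCriterion {p d : ℕ} (b : EuclideanSpace ℝ (Fin p) → EuclideanSpace ℝ (Fin d))
    (Sig : EuclideanSpace ℝ (Fin p) → Matrix (Fin d) (Fin d) ℝ) (b₀ : EuclideanSpace ℝ (Fin d))
    (θ : EuclideanSpace ℝ (Fin p)) : ℝ :=
  -(1 / 2) * ((b θ - b₀).ofLp ⬝ᵥ (Sig θ)⁻¹ *ᵥ (b θ - b₀).ofLp)

namespace Experiment

variable {p d : ℕ} (E : Experiment p d)

/-- Model mean of the summaries. -/
def mean (n : ℕ) (θ : EuclideanSpace ℝ (Fin p)) : EuclideanSpace ℝ (Fin d) :=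
  ∫ z, E.S n z ∂(E.P n θ)

/-- Model covariance matrix `Σₙ(θ)` of the summaries. -/
def covMat (n : ℕ) (θ : EuclideanSpace ℝ (Fin p)) : Matrix (Fin d) (Fin d) ℝ :=
  Matrix.of fun i j => covariance (fun z => E.S n z i) (fun z => E.S n z j) (E.P n θ)

/-- The exact synthetic likelihood `gₙ(s | θ)`. -/
def exactSL (n : ℕ) (s : EuclideanSpace ℝ (Fin d)) (θ : EuclideanSpace ℝ (Fin p)) : ℝ :=
  normalDensity s (E.mean n θ) (E.covMat n θ)

/-- The estimated synthetic likelihood: the expectation of the normal density with the sample mean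
and sample covariance of `m` independent simulated summaries plugged in. -/
def estSL (n m : ℕ) (s : EuclideanSpace ℝ (Fin d)) (θ : EuclideanSpace ℝ (Fin p)) : ℝ :=
  ∫ z : Fin m → Fin n → ℝ,
    normalDensity s (sampleMean fun k => E.S n (z k)) (sampleCov fun k => E.S n (z k))
    ∂(Measure.pi fun _ => E.P n θ)

/-- The score `Mₙ(θ) = n⁻¹ ∂ log gₙ(Sₙ | θ) / ∂θ`. -/
def score (n : ℕ) (θ : EuclideanSpace ℝ (Fin p)) (y : Fin n → ℝ) : EuclideanSpace ℝ (Fin p) :=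
  (n : ℝ)⁻¹ • gradient (fun θ' => Real.log (E.exactSL n (E.S n y) θ')) θ

/-- The Hessian `Hₙ(θ) = n⁻¹ ∂² log gₙ(Sₙ | θ) / ∂θ∂θᵀ`. -/
def hess (n : ℕ) (θ : EuclideanSpace ℝ (Fin p)) (y : Fin n → ℝ) : Matrix (Fin p) (Fin p) ℝ :=
  Matrix.of fun i j => (n : ℝ)⁻¹ *
    iteratedFDeriv ℝ 2 (fun θ' => Real.log (E.exactSL n (E.S n y) θ')) θ
      ![EuclideanSpace.single i 1, EuclideanSpace.single j 1]

/-- `Θ⋆`: the interior zeros of the limit score `M`. -/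
def roots (M : EuclideanSpace ℝ (Fin p) → EuclideanSpace ℝ (Fin p)) :
    Set (EuclideanSpace ℝ (Fin p)) :=
  {θ | θ ∈ interior E.Θ ∧ M θ = 0}

/-- The BSL posterior density (with respect to Lebesgue measure on `Θ`). -/
def posterior (n m : ℕ) (y : Fin n → ℝ) (θ : EuclideanSpace ℝ (Fin p)) : ℝ :=
  E.prior θ * E.estSL n m (E.S n y) θ /
    ∫ θ' in E.Θ, E.prior θ' * E.estSL n m (E.S n y) θ'

def posteriorMean (n m : ℕ) (y : Fin n → ℝ) : EuclideanSpace ℝ (Fin p) :=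
  ∫ θ in E.Θ, E.posterior n m y θ • θ

def posteriorCov (n m : ℕ) (y : Fin n → ℝ) : Matrix (Fin p) (Fin p) ℝ :=
  Matrix.of fun i j => ∫ θ in E.Θ, E.posterior n m y θ *
    ((θ i - E.posteriorMean n m y i) * (θ j - E.posteriorMean n m y j))

/-- The credible set for the linear functional `aᵀθ`: posterior mean `± z` posterior standard
deviations. -/
def credibleSet (n m : ℕ) (a : EuclideanSpace ℝ (Fin p)) (z : ℝ) (y : Fin n → ℝ) :
    Set (EuclideanSpace ℝ (Fin p)) :=
  {θ | |a.ofLp ⬝ᵥ (θ - E.posteriorMean n m y).ofLp| ≤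
    z * Real.sqrt (a.ofLp ⬝ᵥ E.posteriorCov n m y *ᵥ a.ofLp)}

end Experiment

/-- The mass that the centred normal law with variance `v` gives to `[-r, r]`. -/
def normalMass (v r : ℝ) : ℝ := (gaussianReal 0 v.toNNReal).real (Icc (-r) r)

end

end BSL

/-! ### Gaussian laws: densities, moments, linear images and masses of symmetric intervals. -/

namespace BSL

/-! The estimated likelihood equals the exact one up to a uniform factor `1 + o_p(1)`, so the matter
is a Laplace approximation of the exact one. Put `J = -H θs`, `r = √n` and let `Z` be `√n` times the
score at `θs`. Since the Hessian is locally Lipschitz, the log likelihood ratio at `θs + h` is `r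
⟨Z, h⟩ - r² hᵀJh / 2` up to a small multiple of `r²‖h‖²`. Completing the square, the posterior of `u
= r (θ - θs) - J⁻¹ Z` looks like `N(0, J⁻¹)`. Away from `θs` the normalized log ratio converges
uniformly to a strictly negative limit, so that region has exponentially small mass. Dominated
convergence (`tendsto_near`, `tendsto_far`) allows weights of quadratic growth, which covers the
mean, the covariance and credible sets alike.

The spread of the posterior is thus fixed by the curvature `J` alone, while its centre is `θs + J⁻¹
Z / r + o_p(1/r)` and fluctuates with the covariance of the score. Slutsky's theorem turns this
expansion into the sandwich law, and strict monotonicity of the Gaussian mass in the variance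
(`normalMass_lt`) separates the two limits.

Probability and analysis are kept apart. `GoodAt` collects the random conditions at tolerance `ε`,
and they hold with probability close to one. If a quantity converges along every deterministic
sequence of outcomes that are good at tolerance `1/(k+1)`, it converges in probability
(`tendstoInProb_of_goodAt`). Along such a sequence `Regular.laplaceSetting` supplies the hypotheses
of the purely deterministic theory of `LaplaceSetting`. -/

theorem integrable_exp_neg_mul_sq_norm {p : ℕ} {c : ℝ} (hc : 0 < c) :
    Integrable fun u : EuclideanSpace ℝ (Fin p) => Real.exp (-c * ‖u‖ ^ 2) := by
  have h := GaussianFourier.integrable_cexp_neg_mul_sq_norm_add (V := EuclideanSpace ℝ (Fin p))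
    (b := (c : ℂ)) (by simpa using hc) 0 0
  have h2 := h.norm
  refine h2.congr (ae_of_all _ fun u => ?_)
  simp only [Complex.norm_exp]
  congr 1
  simp [← Complex.ofReal_pow]

/-- Characteristic functions determine finite measures, and that of the weighted Lebesgue measure is
the complex Gaussian integral. -/
theorem stdGaussian_eq_withDensity (p : ℕ) :
    stdGaussian (EuclideanSpace ℝ (Fin p)) =
      (volume : Measure (EuclideanSpace ℝ (Fin p))).withDensity
        (fun x => ENNReal.ofReal ((2 * Real.pi) ^ (-(p / 2 : ℝ)) *
          Real.exp (-(1 / 2) * ‖x‖ ^ 2))) := by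
  have hint : Integrable fun x : EuclideanSpace ℝ (Fin p) =>
      (2 * Real.pi) ^ (-(p / 2 : ℝ)) * Real.exp (-(1 / 2) * ‖x‖ ^ 2) :=
    (integrable_exp_neg_mul_sq_norm (by norm_num)).const_mul _
  have := isFiniteMeasure_withDensity_ofReal hint.2
  apply Measure.ext_of_charFun
  ext t
  rw [charFun_stdGaussian, charFun_apply, integral_withDensity_eq_integral_toReal_smul
    (by fun_prop) (ae_of_all _ fun _ => ENNReal.ofReal_lt_top)]
  have h1 := GaussianFourier.integral_cexp_neg_mul_sq_norm_add (V := EuclideanSpace ℝ (Fin p))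
    (b := (1 / 2 : ℂ)) (by norm_num) Complex.I t
  have h2 : ∀ x : EuclideanSpace ℝ (Fin p),
      (ENNReal.ofReal ((2 * Real.pi) ^ (-(p / 2 : ℝ)) * Real.exp (-(1 / 2) * ‖x‖ ^ 2))).toReal •
        Complex.exp (inner ℝ x t * Complex.I) = ((2 * Real.pi) ^ (-(p / 2 : ℝ)) : ℝ) *
          Complex.exp (-(1 / 2 : ℂ) * ‖x‖ ^ 2 + Complex.I * inner ℝ t x) := by
    intro x
    rw [ENNReal.toReal_ofReal (by positivity), Complex.exp_add, real_inner_comm t x]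
    simp only [Complex.real_smul]
    push_cast
    rw [mul_comm Complex.I]
    ring
  simp_rw [h2]
  rw [integral_const_mul, h1]
  have h3 : (((2 * Real.pi) ^ (-(p / 2 : ℝ)) : ℝ) : ℂ) *
      ((Real.pi : ℂ) / (1 / 2)) ^ ((Module.finrank ℝ (EuclideanSpace ℝ (Fin p)) : ℂ) / 2) = 1 := by
    have : (Real.pi : ℂ) / (1 / 2) = ((2 * Real.pi : ℝ) : ℂ) := by push_cast; ring
    rw [this, finrank_euclideanSpace_fin]
    have h4 : ((p : ℂ) / 2) = ((p / 2 : ℝ) : ℂ) := by push_cast; ring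
    rw [h4, ← Complex.ofReal_cpow (by positivity), ← Complex.ofReal_mul,
      ← Real.rpow_add (by positivity)]
    simp
  rw [← mul_assoc, h3, one_mul]
  congr 1
  rw [Complex.I_sq]
  ring

open scoped MatrixOrder in
theorem exists_multivariateGaussian_eq_map {p : ℕ} {Δ : Matrix (Fin p) (Fin p) ℝ}
    (hΔ : Δ.PosDef) :
    ∃ B : Matrix (Fin p) (Fin p) ℝ, B.IsHermitian ∧ B * B = Δ ∧ B.det ≠ 0 ∧
      multivariateGaussian 0 Δ =
        (stdGaussian (EuclideanSpace ℝ (Fin p))).map (Matrix.toEuclideanCLM (𝕜 := ℝ) B) := by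
  have h1 : CFC.sqrt Δ * CFC.sqrt Δ = Δ := CFC.sqrt_mul_sqrt_self _ hΔ.posSemidef.nonneg
  refine ⟨CFC.sqrt Δ, (Matrix.nonneg_iff_posSemidef.1 (CFC.sqrt_nonneg Δ)).1, h1, fun h => ?_, ?_⟩
  · have := hΔ.det_pos
    rw [← h1, Matrix.det_mul, h] at this
    simp at this
  · simp [multivariateGaussian]

/-- The quadratic form of a matrix. -/
def quad {p : ℕ} (A : Matrix (Fin p) (Fin p) ℝ) (u : EuclideanSpace ℝ (Fin p)) : ℝ :=
  u.ofLp ⬝ᵥ A *ᵥ u.ofLp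

theorem continuous_quad {p : ℕ} (A : Matrix (Fin p) (Fin p) ℝ) : Continuous (quad A) := by
  unfold quad dotProduct Matrix.mulVec dotProduct
  fun_prop

/-- The Lebesgue density of `N(0, Δ)`, up to a normalizing constant. -/
theorem exists_integral_gaussian {p : ℕ} {J : Matrix (Fin p) (Fin p) ℝ} (hJ : J.PosDef) :
    ∃ c : ℝ, 0 < c ∧ ∀ f : EuclideanSpace ℝ (Fin p) → ℝ,
      ∫ u, f u * Real.exp (-(1 / 2) * quad J u) =
        c * ∫ u, f u ∂(multivariateGaussian 0 J⁻¹) := by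
  -- `B` is the symmetric square root of `J⁻¹`; the substitution `u = B x` turns `quad J u` into
  -- `‖x‖²`.
  obtain ⟨B, hB1, hB2, hB3, hB4⟩ := exists_multivariateGaussian_eq_map hJ.inv
  have hJu : IsUnit J.det := hJ.det_pos.ne'.isUnit
  have hBu : IsUnit B.det := hB3.isUnit
  have hBJB : B * J * B = 1 := by
    have h1 : J * B * B = 1 := by rw [Matrix.mul_assoc, hB2, Matrix.mul_nonsing_inv _ hJu]
    have h2 : B * (J * B) = 1 := by
      exact mul_eq_one_comm.1 h1
    rw [Matrix.mul_assoc, h2]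
  set T : EuclideanSpace ℝ (Fin p) →L[ℝ] EuclideanSpace ℝ (Fin p) :=
    Matrix.toEuclideanCLM (𝕜 := ℝ) B with hT
  have hTapp : ∀ x, (T x).ofLp = B *ᵥ x.ofLp := fun x => by
    rw [hT, Matrix.ofLp_toEuclideanCLM]
  have hquad : ∀ x, quad J (T x) = ‖x‖ ^ 2 := by
    intro x
    rw [quad, hTapp, Matrix.mulVec_mulVec, Matrix.dotProduct_mulVec, ← Matrix.mulVec_transpose]
    rw [show Matrix.transpose (J * B) = B * J by
      rw [Matrix.transpose_mul]
      rw [show Matrix.transpose B = B from by simpa using hB1.eq,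
        show Matrix.transpose J = J from by simpa using hJ.1.eq]]
    rw [Matrix.mulVec_mulVec, hBJB, Matrix.one_mulVec, EuclideanSpace.real_norm_sq_eq]
    simp [dotProduct, sq]
  have hTinj : Function.Injective T := by
    intro x y hxy
    have := congrArg (fun w => w.ofLp) hxy
    simp only [hTapp] at this
    have h2 := congrArg (fun w => B⁻¹ *ᵥ w) this
    simp only [Matrix.mulVec_mulVec, Matrix.nonsing_inv_mul _ hBu, Matrix.one_mulVec] at h2
    exact (WithLp.ofLp_injective 2) h2
  have hker : LinearMap.ker (T : EuclideanSpace ℝ (Fin p) →ₗ[ℝ] EuclideanSpace ℝ (Fin p)) = ⊥ :=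
    LinearMap.ker_eq_bot.2 hTinj
  have hdet : LinearMap.det (T : EuclideanSpace ℝ (Fin p) →ₗ[ℝ] EuclideanSpace ℝ (Fin p)) ≠ 0 := by
    intro h
    exact (LinearMap.bot_lt_ker_of_det_eq_zero h).ne hker.symm
  -- Change of variables along an embedding needs neither measurability nor integrability of `f`.
  have hemb : MeasurableEmbedding T :=
    T.continuous.measurableEmbedding hTinj
  set c₀ : ℝ := (2 * Real.pi) ^ (-(p / 2 : ℝ))
  have hc₀ : 0 < c₀ := by positivity
  set D : ℝ := |(LinearMap.det (T : EuclideanSpace ℝ (Fin p) →ₗ[ℝ] EuclideanSpace ℝ (Fin p)))⁻¹|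
  have hD : 0 < D := by positivity
  refine ⟨(c₀ * D)⁻¹, by positivity, fun f => ?_⟩
  have h1 : ∫ u, f u ∂(multivariateGaussian 0 J⁻¹) =
      c₀ * ∫ x, f (T x) * Real.exp (-(1 / 2) * ‖x‖ ^ 2) := by
    rw [hB4, hemb.integral_map, stdGaussian_eq_withDensity, integral_withDensity_eq_integral_toReal_smul
      (by fun_prop) (ae_of_all _ fun _ => ENNReal.ofReal_lt_top), ← integral_const_mul]
    congr with x
    rw [ENNReal.toReal_ofReal (by positivity), smul_eq_mul]
    ring
  have h2 : ∫ x, f (T x) * Real.exp (-(1 / 2) * ‖x‖ ^ 2) =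
      D * ∫ u, f u * Real.exp (-(1 / 2) * quad J u) := by
    have := Measure.map_linearMap_addHaar_eq_smul_addHaar
      (volume : Measure (EuclideanSpace ℝ (Fin p))) hdet
    have h3 := hemb.integral_map (μ := volume) (fun u => f u * Real.exp (-(1 / 2) * quad J u))
    have h4 : Measure.map T (volume : Measure (EuclideanSpace ℝ (Fin p))) = ENNReal.ofReal D • volume :=
      this
    rw [h4, integral_smul_measure, ENNReal.toReal_ofReal hD.le] at h3
    simp_rw [hquad] at h3
    rw [← h3, smul_eq_mul]
  rw [h1, h2]
  field_simp

theorem integral_coord_multivariateGaussian {p : ℕ} (Δ : Matrix (Fin p) (Fin p) ℝ) (i : Fin p) :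
    ∫ u, u i ∂(multivariateGaussian (0 : EuclideanSpace ℝ (Fin p)) Δ) = 0 := by
  have h := (EuclideanSpace.proj (𝕜 := ℝ) i).integral_comp_comm
    (μ := multivariateGaussian (0 : EuclideanSpace ℝ (Fin p)) Δ) IsGaussian.integrable_fun_id
  rw [integral_id_multivariateGaussian] at h
  simpa using h

theorem integral_coord_mul_coord_multivariateGaussian {p : ℕ} {Δ : Matrix (Fin p) (Fin p) ℝ}
    (hΔ : Δ.PosSemidef) (i j : Fin p) :
    ∫ u, u i * u j ∂(multivariateGaussian (0 : EuclideanSpace ℝ (Fin p)) Δ) = Δ i j := by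
  have h := covariance_eval_multivariateGaussian (μ := 0) hΔ i j
  rw [covariance] at h
  simpa only [integral_coord_multivariateGaussian, sub_zero] using h

/-- The characteristic function of `aᵀu` at `t` is that of `u` at `t • a`. -/
theorem map_dotProduct_multivariateGaussian {p : ℕ} {Δ : Matrix (Fin p) (Fin p) ℝ}
    (hΔ : Δ.PosSemidef) (a : EuclideanSpace ℝ (Fin p)) :
    (multivariateGaussian (0 : EuclideanSpace ℝ (Fin p)) Δ).map (fun u => a.ofLp ⬝ᵥ u.ofLp) =
      gaussianReal 0 (a.ofLp ⬝ᵥ Δ *ᵥ a.ofLp).toNNReal := by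
  apply Measure.ext_of_charFun
  ext t
  have hmap : (fun u : EuclideanSpace ℝ (Fin p) => a.ofLp ⬝ᵥ u.ofLp) = innerSL ℝ a := by
    ext u
    simp [PiLp.inner_apply, dotProduct, mul_comm]
  rw [hmap, charFun_gaussianReal, charFun_apply_real, integral_map (by fun_prop) (by fun_prop)]
  have h := charFun_multivariateGaussian (μ := 0) hΔ (t • a)
  rw [charFun_apply] at h
  have h0 : 0 ≤ a.ofLp ⬝ᵥ Δ *ᵥ a.ofLp := by simpa using hΔ.dotProduct_mulVec_nonneg a.ofLp
  convert h using 2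
  · ext u
    congr 1
    simp [inner_smul_right, real_inner_comm]
  · simp [h0, Matrix.mulVec_smul]
    ring

theorem map_toEuclideanCLM_multivariateGaussian {p : ℕ} {W : Matrix (Fin p) (Fin p) ℝ}
    (hW : W.PosSemidef) (D : Matrix (Fin p) (Fin p) ℝ) :
    (multivariateGaussian (0 : EuclideanSpace ℝ (Fin p)) W).map
      (Matrix.toEuclideanCLM (𝕜 := ℝ) D) = multivariateGaussian 0 (D * W * Dᵀ) := by
  have hW' : (D * W * Dᵀ).PosSemidef := by
    simpa using hW.mul_mul_conjTranspose_same D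
  apply Measure.ext_of_charFun
  ext t
  have h := charFun_multivariateGaussian (μ := 0) hW (WithLp.toLp 2 (Dᵀ *ᵥ t.ofLp))
  rw [charFun_multivariateGaussian hW', charFun_apply, integral_map (by fun_prop) (by fun_prop)]
  rw [charFun_apply] at h
  have h1 : ∀ u : EuclideanSpace ℝ (Fin p), inner ℝ (Matrix.toEuclideanCLM (𝕜 := ℝ) D u) t =
      inner ℝ u (WithLp.toLp 2 (Dᵀ *ᵥ t.ofLp)) := by
    intro u
    rw [real_inner_comm, Matrix.inner_toEuclideanCLM, EuclideanSpace.inner_eq_star_dotProduct,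
      Matrix.dotProduct_mulVec, Matrix.mulVec_transpose]
    simp
  simp_rw [h1, h]
  simp only [inner_zero_right, ← Matrix.mulVec_mulVec, Matrix.dotProduct_mulVec,
    Matrix.mulVec_transpose, Matrix.vecMul_vecMul]

/-- Scaling a single standard normal variable makes different variances comparable under one
measure, including variance zero. -/
theorem normalMass_eq {v : ℝ} (hv : 0 ≤ v) (r : ℝ) :
    normalMass v r = (gaussianReal 0 1).real {x | |√v * x| ≤ r} := by
  have h : gaussianReal 0 v.toNNReal = (gaussianReal 0 1).map (√v * ·) := by
    rw [gaussianReal_map_const_mul]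
    congr 1
    · simp
    · ext
      simp [hv]
  rw [normalMass, h, measureReal_def, measureReal_def, Measure.map_apply (by fun_prop) measurableSet_Icc]
  congr 2
  ext x
  simp only [mem_preimage, mem_Icc, mem_ofPred_eq, abs_le]

/-- In the standard coordinate the event for `w` lies inside the event for `v`, and the gap contains
the nonempty open set `U`, which has positive Gaussian mass. -/
theorem normalMass_lt {v w r : ℝ} (hv : 0 ≤ v) (hvw : v < w) (hr : 0 < r) :
    normalMass w r < normalMass v r := by
  have hw : 0 < √w := Real.sqrt_pos.2 (hv.trans_lt hvw)
  have hs : √v < √w := Real.sqrt_lt_sqrt hv hvw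
  rw [normalMass_eq hv, normalMass_eq (hv.trans hvw.le)]
  set U : Set ℝ := {x | √v * x < r ∧ r < √w * x ∧ 0 < x} with hU
  have hUo : IsOpen U := by
    apply IsOpen.and <;> [skip; apply IsOpen.and] <;>
      exact isOpen_lt (by fun_prop) (by fun_prop)
  have hUne : U.Nonempty := by
    have h0 : 0 ≤ √v := Real.sqrt_nonneg v
    -- `r` divided by the average of the two standard deviations.
    refine ⟨2 * r / (√v + √w), ?_, ?_, by positivity⟩
    · rw [mul_div_assoc', div_lt_iff₀ (by positivity)]
      nlinarith
    · rw [mul_div_assoc', lt_div_iff₀ (by positivity)]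
      nlinarith
  have hUpos : 0 < (gaussianReal 0 1).real U := by
    rw [measureReal_def, ENNReal.toReal_pos_iff]
    refine ⟨pos_iff_ne_zero.2 fun h => ?_, measure_lt_top _ _⟩
    exact (hUo.measure_pos volume hUne).ne' (gaussianReal_absolutelyContinuous' 0 one_ne_zero h)
  have hdisj : Disjoint {x | |√w * x| ≤ r} U := by
    rw [Set.disjoint_left]
    intro x hx hx'
    exact absurd (le_of_abs_le hx) (not_le.2 hx'.2.1)
  have hsub : {x | |√w * x| ≤ r} ∪ U ⊆ {x | |√v * x| ≤ r} := by
    rintro x (hx | hx)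
    · refine le_trans ?_ (show |√w * x| ≤ r from hx)
      rw [abs_mul, abs_mul, abs_of_nonneg (Real.sqrt_nonneg v), abs_of_nonneg hw.le]
      gcongr
    · have : 0 ≤ √v * x := mul_nonneg (Real.sqrt_nonneg v) hx.2.2.le
      exact (abs_of_nonneg this).le.trans hx.1.le
  have := measureReal_mono (μ := gaussianReal 0 1) hsub
  rw [measureReal_union hdisj hUo.measurableSet] at this
  linarith

theorem normalMass_ne {v w r : ℝ} (hv : 0 ≤ v) (hw : 0 ≤ w) (hvw : v ≠ w) (hr : 0 < r) :
    normalMass v r ≠ normalMass w r := by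
  rcases lt_or_gt_of_ne hvw with h | h
  · exact (normalMass_lt hv h hr).ne'
  · exact (normalMass_lt hw h hr).ne

/-- A symmetric matrix is determined by its quadratic form. -/
theorem exists_quad_ne {p : ℕ} {A B : Matrix (Fin p) (Fin p) ℝ} (hA : Aᵀ = A) (hB : Bᵀ = B)
    (hAB : A ≠ B) : ∃ a, quad A a ≠ quad B a := by
  by_contra! h
  apply hAB
  -- Polarization recovers each entry from values of the form on basis vectors and their sums.
  have key : ∀ C : Matrix (Fin p) (Fin p) ℝ, Cᵀ = C → ∀ i j,
      quad C (EuclideanSpace.single i 1 + EuclideanSpace.single j 1) =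
        quad C (EuclideanSpace.single i 1) + quad C (EuclideanSpace.single j 1) + 2 * C i j := by
    intro C hC i j
    have hs : C j i = C i j := by conv_lhs => rw [← hC, Matrix.transpose_apply]
    simp [quad, Matrix.mulVec_add, hs]
    ring
  ext i j
  have h1 := key A hA i j
  have h2 := key B hB i j
  rw [h, h, h] at h1
  linarith

end BSL

/-! ### The deterministic Laplace setting: local coordinates and a priori bounds. -/

namespace BSL

/-- The form has a positive minimum on the compact unit sphere, and homogeneity does the rest. An
empty sphere means dimension zero. -/
theorem exists_quad_ge {p : ℕ} {J : Matrix (Fin p) (Fin p) ℝ} (hJ : J.PosDef) :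
    ∃ κ : ℝ, 0 < κ ∧ ∀ u : EuclideanSpace ℝ (Fin p), κ * ‖u‖ ^ 2 ≤ quad J u := by
  have hpos : ∀ u : EuclideanSpace ℝ (Fin p), u ≠ 0 → 0 < quad J u := fun u hu => by
    have h := hJ.dotProduct_mulVec_pos (x := u.ofLp) (by simpa using hu)
    simpa [quad] using h
  rcases (Metric.sphere (0 : EuclideanSpace ℝ (Fin p)) 1).eq_empty_or_nonempty with he | hne
  · refine ⟨1, one_pos, fun u => ?_⟩
    have hu : u = 0 := by
      by_contra hu
      have : (‖u‖⁻¹ • u) ∈ Metric.sphere (0 : EuclideanSpace ℝ (Fin p)) 1 := by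
        simp [norm_smul, hu]
      simp [he] at this
    simp [hu, quad]
  · obtain ⟨v, hv, hmin⟩ := (isCompact_sphere (0 : EuclideanSpace ℝ (Fin p)) 1).exists_isMinOn hne
      (continuous_quad J).continuousOn
    have hv0 : v ≠ 0 := by
      rintro rfl
      simp at hv
    refine ⟨quad J v, hpos v hv0, fun u => ?_⟩
    by_cases hu : u = 0
    · simp [hu, quad]
    · have h1 : quad J v ≤ quad J (‖u‖⁻¹ • u) := hmin (by simp [norm_smul, hu])
      have h2 : quad J (‖u‖⁻¹ • u) = (‖u‖ ^ 2)⁻¹ * quad J u := by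
        simp [quad, Matrix.mulVec_smul]
        ring
      have h3 : 0 < ‖u‖ ^ 2 := by positivity
      rw [h2, inv_mul_eq_div, le_div_iff₀ h3] at h1
      exact h1

/-- A sequence of unnormalized posteriors whose log likelihood ratios `L k` are, after division by
`r k ^ 2`, well separated away from `θs` and close to a negative definite quadratic near `θs`. -/
structure LaplaceSetting {p : ℕ} (Θ : Set (EuclideanSpace ℝ (Fin p)))
    (prior : EuclideanSpace ℝ (Fin p) → ℝ) (θs : EuclideanSpace ℝ (Fin p))
    (J : Matrix (Fin p) (Fin p) ℝ) (r : ℕ → ℝ) (Z : ℕ → EuclideanSpace ℝ (Fin p))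
    (L G : ℕ → EuclideanSpace ℝ (Fin p) → ℝ) : Prop where
  compact : IsCompact Θ
  mem_interior : θs ∈ interior Θ
  measurable_prior : Measurable prior
  prior_pos : 0 < prior θs
  integrable_prior : IntegrableOn prior Θ
  continuousAt_prior : ContinuousAt prior θs
  posDef : J.PosDef
  tendsto_r : Tendsto r atTop atTop
  bounded_Z : ∃ T, ∀ k, ‖Z k‖ ≤ T
  measurable_G : ∀ k, Measurable (G k)
  approx : ∀ ε, 0 < ε → ∀ᶠ k in atTop, ∀ θ ∈ Θ,
    |G k θ - Real.exp (L k θ)| ≤ ε * Real.exp (L k θ)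
  separated : ∀ ε, 0 < ε → ∃ η, 0 < η ∧ ∀ᶠ k in atTop, ∀ θ ∈ Θ, ε ≤ dist θ θs →
    L k θ ≤ -η * r k ^ 2
  quadratic : ∀ ε, 0 < ε → ∃ ρ, 0 < ρ ∧ ∀ᶠ k in atTop, ∀ h : EuclideanSpace ℝ (Fin p), ‖h‖ ≤ ρ →
    |L k (θs + h) - r k * inner ℝ (Z k) h + 1 / 2 * r k ^ 2 * quad J h| ≤ ε * r k ^ 2 * ‖h‖ ^ 2

/-- The local coordinate `r (θ - θs) - J⁻¹ Z`. -/
noncomputable def localCoord {p : ℕ} (θs : EuclideanSpace ℝ (Fin p)) (J : Matrix (Fin p) (Fin p) ℝ)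
    (r : ℝ) (Z θ : EuclideanSpace ℝ (Fin p)) : EuclideanSpace ℝ (Fin p) :=
  r • (θ - θs) - Matrix.toEuclideanCLM (𝕜 := ℝ) J⁻¹ Z

/-- The inverse of the local coordinate. -/
noncomputable def localInv {p : ℕ} (θs : EuclideanSpace ℝ (Fin p)) (J : Matrix (Fin p) (Fin p) ℝ)
    (r : ℝ) (Z u : EuclideanSpace ℝ (Fin p)) : EuclideanSpace ℝ (Fin p) :=
  θs + r⁻¹ • (u + Matrix.toEuclideanCLM (𝕜 := ℝ) J⁻¹ Z)

theorem localCoord_localInv {p : ℕ} (θs : EuclideanSpace ℝ (Fin p)) (J : Matrix (Fin p) (Fin p) ℝ)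
    {r : ℝ} (hr : r ≠ 0) (Z u : EuclideanSpace ℝ (Fin p)) :
    localCoord θs J r Z (localInv θs J r Z u) = u := by
  simp [localCoord, localInv, hr]

theorem measurable_localCoord {p : ℕ} (θs : EuclideanSpace ℝ (Fin p))
    (J : Matrix (Fin p) (Fin p) ℝ) (r : ℝ) (Z : EuclideanSpace ℝ (Fin p)) :
    Measurable (localCoord θs J r Z) := by
  unfold localCoord; fun_prop

theorem measurable_localInv {p : ℕ} (θs : EuclideanSpace ℝ (Fin p))
    (J : Matrix (Fin p) (Fin p) ℝ) (r : ℝ) (Z : EuclideanSpace ℝ (Fin p)) :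
    Measurable (localInv θs J r Z) := by
  unfold localInv; fun_prop

/-- The map is a dilation by `r⁻¹` combined with translations, so its Jacobian is `r⁻ᵖ`,
independently of `Z`. -/
theorem pow_mul_integral_eq_integral_localInv {p : ℕ} (θs : EuclideanSpace ℝ (Fin p))
    (J : Matrix (Fin p) (Fin p) ℝ) {r : ℝ} (hr : 0 < r) (Z : EuclideanSpace ℝ (Fin p))
    (F : EuclideanSpace ℝ (Fin p) → ℝ) :
    r ^ p * ∫ θ, F θ = ∫ u, F (localInv θs J r Z u) := by
  unfold localInv
  rw [integral_add_right_eq_self (fun u => F (θs + r⁻¹ • u)),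
    Measure.integral_comp_smul volume (fun u => F (θs + u)), integral_add_left_eq_self]
  rw [finrank_euclideanSpace_fin, smul_eq_mul, abs_of_pos (by positivity)]
  simp

/-- Completing the square. -/
theorem complete_square {p : ℕ} {J : Matrix (Fin p) (Fin p) ℝ} (hJ : J.PosDef)
    (Z u : EuclideanSpace ℝ (Fin p)) :
    -(1 / 2) * quad J⁻¹ Z + (inner ℝ Z (u + Matrix.toEuclideanCLM (𝕜 := ℝ) J⁻¹ Z) -
      1 / 2 * quad J (u + Matrix.toEuclideanCLM (𝕜 := ℝ) J⁻¹ Z)) = -(1 / 2) * quad J u := by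
  have hJu : IsUnit J.det := hJ.det_pos.ne'.isUnit
  have hJt : Jᵀ = J := by simpa using hJ.1.eq
  have h1 : ∀ v : EuclideanSpace ℝ (Fin p), inner ℝ Z v = Z.ofLp ⬝ᵥ v.ofLp := fun v => by
    simp [EuclideanSpace.inner_eq_star_dotProduct, dotProduct_comm]
  have h2 : u.ofLp ⬝ᵥ J *ᵥ (J⁻¹ *ᵥ Z.ofLp) = Z.ofLp ⬝ᵥ u.ofLp := by
    rw [Matrix.mulVec_mulVec, Matrix.mul_nonsing_inv _ hJu, Matrix.one_mulVec, dotProduct_comm]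
  have h3 : (J⁻¹ *ᵥ Z.ofLp) ⬝ᵥ J *ᵥ u.ofLp = Z.ofLp ⬝ᵥ u.ofLp := by
    rw [Matrix.dotProduct_mulVec, ← Matrix.mulVec_transpose, hJt, Matrix.mulVec_mulVec,
      Matrix.mul_nonsing_inv _ hJu, Matrix.one_mulVec]
  have h4 : (J⁻¹ *ᵥ Z.ofLp) ⬝ᵥ J *ᵥ (J⁻¹ *ᵥ Z.ofLp) = Z.ofLp ⬝ᵥ J⁻¹ *ᵥ Z.ofLp := by
    rw [Matrix.mulVec_mulVec, Matrix.mul_nonsing_inv _ hJu, Matrix.one_mulVec, dotProduct_comm]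
  rw [h1]
  simp only [quad, WithLp.ofLp_add, Matrix.ofLp_toEuclideanCLM, Matrix.mulVec_add, dotProduct_add,
    add_dotProduct, h2, h3, h4]
  ring

namespace LaplaceSetting

variable {p : ℕ} {Θ : Set (EuclideanSpace ℝ (Fin p))}
    {prior : EuclideanSpace ℝ (Fin p) → ℝ} {θs : EuclideanSpace ℝ (Fin p)}
    {J : Matrix (Fin p) (Fin p) ℝ} {r : ℕ → ℝ} {Z : ℕ → EuclideanSpace ℝ (Fin p)}
    {L G : ℕ → EuclideanSpace ℝ (Fin p) → ℝ} (S : LaplaceSetting Θ prior θs J r Z L G)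

include S

theorem exists_bound_center : ∃ T, 0 ≤ T ∧ ∀ k, ‖Z k‖ ≤ T ∧
    ‖Matrix.toEuclideanCLM (𝕜 := ℝ) J⁻¹ (Z k)‖ ≤ T := by
  obtain ⟨T, hT⟩ := S.bounded_Z
  have hT0 : 0 ≤ T := (norm_nonneg _).trans (hT 0)
  set A := Matrix.toEuclideanCLM (𝕜 := ℝ) J⁻¹
  refine ⟨T + ‖A‖ * T, by positivity, fun k => ⟨?_, ?_⟩⟩
  · have := hT k
    have : 0 ≤ ‖A‖ * T := by positivity
    linarith [hT k]
  · calc ‖A (Z k)‖ ≤ ‖A‖ * ‖Z k‖ := A.le_opNorm _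
      _ ≤ ‖A‖ * T := by gcongr; exact hT k
      _ ≤ _ := by linarith

/-- An expansion error of at most a quarter of the lower bound for `quad J` still leaves a negative
quadratic term. This is the source of the Gaussian envelope in the dominated convergence argument.
-/
theorem exists_upper : ∃ κ ρ₀, 0 < κ ∧ 0 < ρ₀ ∧ ∀ᶠ k in atTop, ∀ h : EuclideanSpace ℝ (Fin p),
    ‖h‖ ≤ ρ₀ → L k (θs + h) ≤ r k * inner ℝ (Z k) h - κ * r k ^ 2 * ‖h‖ ^ 2 := by
  obtain ⟨κ, hκ, hq⟩ := exists_quad_ge S.posDef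
  obtain ⟨ρ, hρ, h⟩ := S.quadratic (κ / 4) (by positivity)
  refine ⟨κ / 4, ρ, by positivity, hρ, h.mono fun k hk h hh => ?_⟩
  have h1 := (abs_le.1 (hk h hh)).2
  have h2 := mul_le_mul_of_nonneg_left (hq h) (by positivity : 0 ≤ 1 / 2 * r k ^ 2)
  nlinarith

theorem exists_G_le : ∃ B, 0 ≤ B ∧ ∀ᶠ k in atTop, ∀ θ ∈ Θ, |G k θ| ≤ B := by
  obtain ⟨T, hT0, hT⟩ := S.exists_bound_center
  obtain ⟨κ, ρ₀, hκ, hρ₀, hup⟩ := S.exists_upper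
  obtain ⟨η, hη, hsep⟩ := S.separated ρ₀ hρ₀
  -- `T² / (4κ)` is the maximum of `T s - κ s²`; the factor `2` comes from the relative error of `G`
  -- with tolerance one.
  refine ⟨2 * Real.exp (T ^ 2 / (4 * κ)), by positivity, ?_⟩
  filter_upwards [hup, hsep, S.approx 1 one_pos] with k h1 h2 h3 θ hθ
  have hL : L k θ ≤ T ^ 2 / (4 * κ) := by
    rcases le_total ρ₀ (dist θ θs) with hd | hd
    · have := h2 θ hθ hd
      have h5 : 0 ≤ η * r k ^ 2 := by positivity
      have h6 : 0 ≤ T ^ 2 / (4 * κ) := by positivity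
      linarith
    · have h4 := h1 (θ - θs) (by rwa [← dist_eq_norm])
      rw [add_sub_cancel] at h4
      refine h4.trans ?_
      have h5 : r k * inner ℝ (Z k) (θ - θs) ≤ |r k| * (T * ‖θ - θs‖) := by
        refine (le_abs_self _).trans ?_
        rw [abs_mul]
        gcongr
        exact (abs_real_inner_le_norm _ _).trans (by gcongr; exact (hT k).1)
      rw [le_div_iff₀ (by positivity)]
      have h6 := sq_nonneg (T - 2 * κ * (|r k| * ‖θ - θs‖))
      have h7 : r k ^ 2 = |r k| ^ 2 := (sq_abs _).symm
      rw [h7]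
      nlinarith
  have h4 := h3 θ hθ
  have h5 : |G k θ| ≤ 2 * Real.exp (L k θ) := by
    have h6 := abs_sub_abs_le_abs_sub (G k θ) (Real.exp (L k θ))
    rw [abs_of_pos (Real.exp_pos (L k θ))] at h6
    linarith
  exact h5.trans (by gcongr)

end LaplaceSetting
end BSL

/-! ### The Laplace integral near `θs`. -/

namespace BSL

/-- Half of the exponential decay absorbs the polynomial factor. This is the dominating function for
all weights used later. -/
theorem integrable_one_add_sq_mul_exp {p : ℕ} {c : ℝ} (hc : 0 < c) :
    Integrable fun u : EuclideanSpace ℝ (Fin p) => (1 + ‖u‖ ^ 2) * Real.exp (-c * ‖u‖ ^ 2) := by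
  refine Integrable.mono' ((integrable_exp_neg_mul_sq_norm (p := p) (half_pos hc)).const_mul
    (1 + 2 / c)) (by fun_prop) (ae_of_all _ fun u => ?_)
  rw [Real.norm_of_nonneg (by positivity)]
  have h1 : c / 2 * ‖u‖ ^ 2 ≤ Real.exp (c / 2 * ‖u‖ ^ 2) :=
    (by linarith [Real.add_one_le_exp (c / 2 * ‖u‖ ^ 2)])
  have h2 : 1 ≤ Real.exp (c / 2 * ‖u‖ ^ 2) := Real.one_le_exp (by positivity)
  have h3 : 1 + ‖u‖ ^ 2 ≤ (1 + 2 / c) * Real.exp (c / 2 * ‖u‖ ^ 2) := by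
    have : ‖u‖ ^ 2 = 2 / c * (c / 2 * ‖u‖ ^ 2) := by field_simp
    have h4 := mul_le_mul_of_nonneg_left h1 (by positivity : 0 ≤ 2 / c)
    rw [← this] at h4
    linarith
  calc (1 + ‖u‖ ^ 2) * Real.exp (-c * ‖u‖ ^ 2)
      ≤ (1 + 2 / c) * Real.exp (c / 2 * ‖u‖ ^ 2) * Real.exp (-c * ‖u‖ ^ 2) := by gcongr
    _ = (1 + 2 / c) * Real.exp (-(c / 2) * ‖u‖ ^ 2) := by
      rw [mul_assoc, ← Real.exp_add]; ring_nf

namespace LaplaceSetting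

variable {p : ℕ} {Θ : Set (EuclideanSpace ℝ (Fin p))}
    {prior : EuclideanSpace ℝ (Fin p) → ℝ} {θs : EuclideanSpace ℝ (Fin p)}
    {J : Matrix (Fin p) (Fin p) ℝ} {r : ℕ → ℝ} {Z : ℕ → EuclideanSpace ℝ (Fin p)}
    {L G : ℕ → EuclideanSpace ℝ (Fin p) → ℝ} (S : LaplaceSetting Θ prior θs J r Z L G)

include S

theorem tendsto_localInv (u : EuclideanSpace ℝ (Fin p)) :
    Tendsto (fun k => localInv θs J (r k) (Z k) u) atTop (𝓝 θs) := by
  obtain ⟨T, hT0, hT⟩ := S.exists_bound_center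
  have h : Tendsto (fun k => (r k)⁻¹ • (u + Matrix.toEuclideanCLM (𝕜 := ℝ) J⁻¹ (Z k))) atTop
      (𝓝 0) := by
    have h0 : Tendsto (fun k => ‖(r k)⁻¹‖ * (‖u‖ + T)) atTop (𝓝 0) := by
      simpa using (tendsto_inv_atTop_zero.comp S.tendsto_r).norm.mul_const (‖u‖ + T)
    refine squeeze_zero_norm (fun k => ?_) h0
    rw [norm_smul]
    gcongr
    exact (norm_add_le _ _).trans (by gcongr; exact (hT k).2)
  simpa [localInv] using h.const_add θs

/-- At a fixed local coordinate the displacement is `h = (u + J⁻¹ Z) / r`, so the expansion error `ε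
r²‖h‖² = ε ‖u + J⁻¹ Z‖²` is bounded by a multiple of `ε`. The term in `quad J⁻¹ (Z k)` is the
remainder of the completed square; being free of `θ`, it cancels in posterior ratios. -/
theorem tendsto_exponent (u : EuclideanSpace ℝ (Fin p)) :
    Tendsto (fun k => -(1 / 2) * quad J⁻¹ (Z k) + L k (localInv θs J (r k) (Z k) u)) atTop
      (𝓝 (-(1 / 2) * quad J u)) := by
  obtain ⟨T, hT0, hT⟩ := S.exists_bound_center
  rw [Metric.tendsto_nhds]
  intro ε hε
  set D := (‖u‖ + T) ^ 2 + 1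
  have hD : 0 < D := by positivity
  obtain ⟨ρ, hρ, hquad⟩ := S.quadratic (ε / (2 * D)) (by positivity)
  have hnear := (S.tendsto_localInv u).eventually (Metric.closedBall_mem_nhds θs hρ)
  filter_upwards [hquad, hnear, S.tendsto_r.eventually_gt_atTop 0] with k hk hn hr
  set m := Matrix.toEuclideanCLM (𝕜 := ℝ) J⁻¹ (Z k) with hm
  set h := (r k)⁻¹ • (u + m) with hh
  have hθ : localInv θs J (r k) (Z k) u = θs + h := rfl
  rw [hθ] at hn ⊢
  have hnorm : ‖h‖ ≤ ρ := by simpa [dist_eq_norm] using hn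
  have h1 := hk h hnorm
  have h2 : r k * inner ℝ (Z k) h = inner ℝ (Z k) (u + m) := by
    rw [hh, inner_smul_right]; field_simp
  have h3 : r k ^ 2 * quad J h = quad J (u + m) := by
    simp only [hh, quad, WithLp.ofLp_smul, Matrix.mulVec_smul, smul_dotProduct, dotProduct_smul,
      smul_eq_mul]
    field_simp
  have h4 : r k ^ 2 * ‖h‖ ^ 2 = ‖u + m‖ ^ 2 := by
    rw [hh, norm_smul, mul_pow, norm_inv, Real.norm_of_nonneg hr.le]
    field_simp
  have h5 := complete_square S.posDef (Z k) u
  rw [← hm] at h5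
  rw [mul_assoc, mul_assoc, h2, h3, h4] at h1
  have h6 : ‖u + m‖ ^ 2 ≤ D := by
    have : ‖u + m‖ ≤ ‖u‖ + T := (norm_add_le _ _).trans (by gcongr; exact (hT k).2)
    have : ‖u + m‖ ^ 2 ≤ (‖u‖ + T) ^ 2 := by gcongr
    exact this.trans (by simp [D])
  have h7 : ε / (2 * D) * ‖u + m‖ ^ 2 ≤ ε / 2 := by
    calc ε / (2 * D) * ‖u + m‖ ^ 2 ≤ ε / (2 * D) * D := by gcongr
      _ = ε / 2 := by field_simp
  rw [Real.dist_eq]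
  refine lt_of_le_of_lt ?_ (half_lt_self hε)
  refine le_trans (le_of_eq ?_) (h1.trans h7)
  congr 1
  linarith

theorem tendsto_likelihood (u : EuclideanSpace ℝ (Fin p)) :
    Tendsto (fun k => Real.exp (-(1 / 2) * quad J⁻¹ (Z k)) * G k (localInv θs J (r k) (Z k) u))
      atTop (𝓝 (Real.exp (-(1 / 2) * quad J u))) := by
  have h1 := (Real.continuous_exp.tendsto _).comp (S.tendsto_exponent u)
  have hnear := (S.tendsto_localInv u).eventually (mem_interior_iff_mem_nhds.1 S.mem_interior)
  have h2 : Tendsto (fun k => Real.exp (-(1 / 2) * quad J⁻¹ (Z k)) *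
      G k (localInv θs J (r k) (Z k) u) - Real.exp (-(1 / 2) * quad J⁻¹ (Z k) +
        L k (localInv θs J (r k) (Z k) u))) atTop (𝓝 0) := by
    rw [Metric.tendsto_nhds]
    intro ε hε
    set D := Real.exp (-(1 / 2) * quad J u) + 1
    have hD : 0 < D := by positivity
    have hlt := h1.eventually_lt_const (lt_add_one (Real.exp (-(1 / 2) * quad J u)))
    filter_upwards [hnear, hlt, S.approx (ε / (2 * D)) (by positivity)] with k hk h3 h4
    have h5 := h4 _ hk
    rw [Real.dist_eq, sub_zero, Real.exp_add, ← mul_sub, abs_mul, abs_of_pos (Real.exp_pos _)]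
    calc _ ≤ Real.exp (-(1 / 2) * quad J⁻¹ (Z k)) * (ε / (2 * D) *
          Real.exp (L k (localInv θs J (r k) (Z k) u))) := by gcongr
      _ = ε / (2 * D) * Real.exp (-(1 / 2) * quad J⁻¹ (Z k) +
          L k (localInv θs J (r k) (Z k) u)) := by rw [Real.exp_add]; ring
      _ ≤ ε / (2 * D) * D := by gcongr; exact h3.le
      _ = ε / 2 := by field_simp
      _ < ε := half_lt_self hε
  simpa using h2.add h1

/-- Dominated convergence in the local coordinate. The weights may vary with `k` so that centring at
the posterior mean and credible sets of varying width are covered. -/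
theorem tendsto_near : ∃ ρ₀, 0 < ρ₀ ∧ ∀ ρ, 0 < ρ → ρ ≤ ρ₀ →
    ∀ (w : ℕ → EuclideanSpace ℝ (Fin p) → ℝ) (w' : EuclideanSpace ℝ (Fin p) → ℝ) (C : ℝ),
    (∀ k, Measurable (w k)) → (∀ᶠ k in atTop, ∀ u, |w k u| ≤ C * (1 + ‖u‖ ^ 2)) →
    (∀ᵐ u, Tendsto (fun k => w k u) atTop (𝓝 (w' u))) →
    Tendsto (fun k => r k ^ p * Real.exp (-(1 / 2) * quad J⁻¹ (Z k)) *
      ∫ θ in Metric.closedBall θs ρ, w k (localCoord θs J (r k) (Z k) θ) * (prior θ * G k θ)) atTop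
      (𝓝 (prior θs * ∫ u, w' u * Real.exp (-(1 / 2) * quad J u))) := by
  obtain ⟨T, hT0, hT⟩ := S.exists_bound_center
  obtain ⟨κ, ρ₁, hκ, hρ₁, hup⟩ := S.exists_upper
  obtain ⟨ρ₂, hρ₂, hρ₂'⟩ := Metric.mem_nhds_iff.1 (mem_interior_iff_mem_nhds.1 S.mem_interior)
  obtain ⟨ρ₃, hρ₃, hρ₃'⟩ := Metric.mem_nhds_iff.1 (S.continuousAt_prior.eventually
    (Ioo_mem_nhds (show 0 < prior θs from S.prior_pos) (lt_two_mul_self S.prior_pos)))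
  -- The three radii ensure the quadratic upper bound, containment in `Θ`, and a prior between `0`
  -- and `2 * prior θs`.
  refine ⟨min ρ₁ (min (ρ₂ / 2) (ρ₃ / 2)), by positivity, ?_⟩
  intro ρ hρ hρle w w' C hw hwC hlim
  have hle₁ : ρ ≤ ρ₁ := hρle.trans (min_le_left _ _)
  have hle₂ : ρ < ρ₂ := by
    have := hρle.trans ((min_le_right _ _).trans (min_le_left _ _)); linarith
  have hle₃ : ρ < ρ₃ := by
    have := hρle.trans ((min_le_right _ _).trans (min_le_right _ _)); linarith
  set N := Metric.closedBall θs ρ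
  have hNΘ : N ⊆ Θ := fun x hx => hρ₂' ((Metric.mem_closedBall.1 hx).trans_lt hle₂)
  have hNp : ∀ x ∈ N, prior x ∈ Ioo 0 (2 * prior θs) := fun x hx =>
    hρ₃' ((Metric.mem_closedBall.1 hx).trans_lt hle₃)
  set F : ℕ → EuclideanSpace ℝ (Fin p) → ℝ := fun k u =>
    Real.exp (-(1 / 2) * quad J⁻¹ (Z k)) * (N.indicator
      (fun θ => w k (localCoord θs J (r k) (Z k) θ) * (prior θ * G k θ))
      (localInv θs J (r k) (Z k) u)) with hF
  have hFeq : ∀ᶠ k in atTop, ∫ u, F k u =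
      r k ^ p * Real.exp (-(1 / 2) * quad J⁻¹ (Z k)) *
        ∫ θ in N, w k (localCoord θs J (r k) (Z k) θ) * (prior θ * G k θ) := by
    filter_upwards [S.tendsto_r.eventually_gt_atTop 0] with k hr
    rw [hF, integral_const_mul, ← pow_mul_integral_eq_integral_localInv θs J hr,
      integral_indicator measurableSet_closedBall]
    ring
  rw [← integral_const_mul]
  refine Tendsto.congr' hFeq ?_
  set B := C * (4 * prior θs * Real.exp (T ^ 2 / (2 * κ) + κ / 2 * T ^ 2))
  refine tendsto_integral_filter_of_dominated_convergence
    (fun u => B * ((1 + ‖u‖ ^ 2) * Real.exp (-(κ / 4) * ‖u‖ ^ 2))) ?_ ?_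
    ((integrable_one_add_sq_mul_exp (by positivity)).const_mul _) ?_
  · refine Eventually.of_forall fun k => Measurable.aestronglyMeasurable ?_
    have hmeas : Measurable (N.indicator
        fun θ => w k (localCoord θs J (r k) (Z k) θ) * (prior θ * G k θ)) :=
      (((hw k).comp (measurable_localCoord _ _ _ _)).mul
        (S.measurable_prior.mul (S.measurable_G k))).indicator measurableSet_closedBall
    exact measurable_const.mul (hmeas.comp (measurable_localInv _ _ _ _))
  · filter_upwards [hwC, hup, S.approx 1 one_pos, S.tendsto_r.eventually_gt_atTop 0] with
      k hwk hupk happ hr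
    refine ae_of_all _ fun u => ?_
    have hC0 : 0 ≤ C * (1 + ‖u‖ ^ 2) := (abs_nonneg _).trans (hwk u)
    have hC : 0 ≤ C := by
      by_contra hC
      have : C * (1 + ‖u‖ ^ 2) < 0 := mul_neg_of_neg_of_pos (not_le.1 hC) (by positivity)
      linarith
    have hp0 := S.prior_pos
    have hB : 0 ≤ B := by positivity
    by_cases hN : localInv θs J (r k) (Z k) u ∈ N
    swap
    · simp only [hF, indicator_of_notMem hN, mul_zero, norm_zero]
      positivity
    simp only [hF, indicator_of_mem hN, localCoord_localInv θs J hr.ne']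
    set θ := localInv θs J (r k) (Z k) u with hθ
    set m := Matrix.toEuclideanCLM (𝕜 := ℝ) J⁻¹ (Z k) with hm
    have hθh : θ = θs + (r k)⁻¹ • (u + m) := rfl
    have hG : |G k θ| ≤ 2 * Real.exp (L k θ) := by
      have h4 := happ θ (hNΘ hN)
      have h6 := abs_sub_abs_le_abs_sub (G k θ) (Real.exp (L k θ))
      rw [abs_of_pos (Real.exp_pos (L k θ))] at h6
      linarith
    -- Young's inequality spends half of `κ ‖u + m‖²` on the linear term; the other half is
    -- converted by `‖u‖² ≤ 2‖u + m‖² + 2T²`.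
    have hL : L k θ ≤ T ^ 2 / (2 * κ) + κ / 2 * T ^ 2 - κ / 4 * ‖u‖ ^ 2 := by
      have h1 := hupk ((r k)⁻¹ • (u + m)) (by
        rw [hθh] at hN
        simpa [N, dist_eq_norm] using (show _ ≤ ρ from hN).trans hle₁)
      rw [← hθh, inner_smul_right, norm_smul, norm_inv, Real.norm_of_nonneg hr.le] at h1
      have h2 : r k * ((r k)⁻¹ * inner ℝ (Z k) (u + m)) = inner ℝ (Z k) (u + m) := by field_simp
      have h3 : κ * r k ^ 2 * ((r k)⁻¹ * ‖u + m‖) ^ 2 = κ * ‖u + m‖ ^ 2 := by field_simp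
      rw [h2, h3] at h1
      have h4 : inner ℝ (Z k) (u + m) ≤ T * ‖u + m‖ :=
        (real_inner_le_norm _ _).trans (by gcongr; exact (hT k).1)
      have h5 : ‖u‖ ≤ ‖u + m‖ + T := by
        calc ‖u‖ = ‖(u + m) - m‖ := by simp
          _ ≤ ‖u + m‖ + ‖m‖ := norm_sub_le _ _
          _ ≤ _ := by gcongr; exact (hT k).2
      have h6 : ‖u‖ ^ 2 ≤ 2 * ‖u + m‖ ^ 2 + 2 * T ^ 2 := by
        have : ‖u‖ ^ 2 ≤ (‖u + m‖ + T) ^ 2 := by gcongr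
        nlinarith [sq_nonneg (‖u + m‖ - T)]
      have h7 : T * ‖u + m‖ ≤ T ^ 2 / (2 * κ) + κ / 2 * ‖u + m‖ ^ 2 := by
        have : T ^ 2 / (2 * κ) + κ / 2 * ‖u + m‖ ^ 2 - T * ‖u + m‖ =
            (T - κ * ‖u + m‖) ^ 2 / (2 * κ) := by field_simp; ring
        have h8 : 0 ≤ (T - κ * ‖u + m‖) ^ 2 / (2 * κ) := by positivity
        linarith
      nlinarith
    have hq : 0 ≤ quad J⁻¹ (Z k) := by
      simpa [quad] using S.posDef.inv.posSemidef.dotProduct_mulVec_nonneg (Z k).ofLp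
    have he : Real.exp (-(1 / 2) * quad J⁻¹ (Z k)) ≤ 1 := Real.exp_le_one_iff.2 (by linarith)
    have hpr := hNp θ hN
    have hpr0 : 0 ≤ prior θ := hpr.1.le
    rw [norm_mul, norm_mul, norm_mul, Real.norm_eq_abs (w k u), Real.norm_eq_abs (G k θ),
      Real.norm_of_nonneg hpr.1.le, Real.norm_of_nonneg (Real.exp_nonneg _)]
    calc _ ≤ 1 * ((C * (1 + ‖u‖ ^ 2)) * (2 * prior θs *
          (2 * Real.exp (T ^ 2 / (2 * κ) + κ / 2 * T ^ 2 - κ / 4 * ‖u‖ ^ 2)))) := by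
          gcongr ?_ * (?_ * (?_ * ?_))
          · exact hwk u
          · exact hpr.2.le
          · exact hG.trans (by gcongr)
      _ = _ := by
          rw [sub_eq_add_neg, Real.exp_add, ← neg_mul]
          ring
  · filter_upwards [hlim] with u hu
    have h1 := S.tendsto_localInv u
    have h2 : ∀ᶠ k in atTop, localInv θs J (r k) (Z k) u ∈ N :=
      h1.eventually (Metric.closedBall_mem_nhds θs hρ)
    have h3 : Tendsto (fun k => prior (localInv θs J (r k) (Z k) u)) atTop (𝓝 (prior θs)) :=
      S.continuousAt_prior.tendsto.comp h1
    have h4 := h3.mul (hu.mul (S.tendsto_likelihood u))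
    refine h4.congr' ?_
    filter_upwards [h2, S.tendsto_r.eventually_gt_atTop 0] with k hk hr
    simp only [hF, indicator_of_mem hk, localCoord_localInv θs J hr.ne']
    ring

end LaplaceSetting
end BSL

/-! ### The far region, and convergence of posterior expectations. -/

namespace BSL

namespace LaplaceSetting

variable {p : ℕ} {Θ : Set (EuclideanSpace ℝ (Fin p))}
    {prior : EuclideanSpace ℝ (Fin p) → ℝ} {θs : EuclideanSpace ℝ (Fin p)}
    {J : Matrix (Fin p) (Fin p) ℝ} {r : ℕ → ℝ} {Z : ℕ → EuclideanSpace ℝ (Fin p)}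
    {L G : ℕ → EuclideanSpace ℝ (Fin p) → ℝ} (S : LaplaceSetting Θ prior θs J r Z L G)

include S

theorem eventually_integrableOn : ∀ᶠ k in atTop, ∀ w : EuclideanSpace ℝ (Fin p) → ℝ, Measurable w →
    (∃ C, ∀ θ ∈ Θ, |w θ| ≤ C) → IntegrableOn (fun θ => w θ * (prior θ * G k θ)) Θ := by
  obtain ⟨B, hB0, hB⟩ := S.exists_G_le
  filter_upwards [hB] with k hk w hw ⟨C, hC⟩
  have h := S.integrable_prior.bdd_mul (g := prior) (c := C * B) (f := fun θ => w θ * G k θ)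
    (hw.mul (S.measurable_G k)).aestronglyMeasurable ?_
  · refine h.congr (ae_of_all _ fun θ => ?_)
    simp only
    ring
  · refine (ae_restrict_iff' S.compact.measurableSet).2 (ae_of_all _ fun θ hθ => ?_)
    rw [norm_mul]
    have := (abs_nonneg _).trans (hC θ hθ)
    gcongr
    · exact hC θ hθ
    · exact hk θ hθ

theorem exists_localCoord_le : ∃ D, 0 ≤ D ∧ ∀ k, ∀ θ ∈ Θ, 1 ≤ r k →
    ‖localCoord θs J (r k) (Z k) θ‖ ≤ D * r k := by
  obtain ⟨T, hT0, hT⟩ := S.exists_bound_center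
  obtain ⟨D, hD⟩ := S.compact.isBounded.subset_closedBall θs
  have hD0 : 0 ≤ D := by
    simpa using hD (interior_subset S.mem_interior)
  refine ⟨D + T, by positivity, fun k θ hθ hr => ?_⟩
  have h1 : ‖θ - θs‖ ≤ D := by simpa [dist_eq_norm] using hD hθ
  calc ‖localCoord θs J (r k) (Z k) θ‖ ≤ ‖r k • (θ - θs)‖ + T :=
        (norm_sub_le _ _).trans (by gcongr; exact (hT k).2)
    _ ≤ r k * D + T * r k := by
        rw [norm_smul, Real.norm_of_nonneg (by linarith)]
        gcongr
        nlinarith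
    _ = _ := by ring

/-- Separation makes the likelihood ratio exponentially small in `r²`, whereas the Jacobian and the
weight grow only like `r ^ (p + 2)` on the bounded set `Θ`. Integrability of the prior suffices to
integrate the bound. -/
theorem tendsto_far {ρ : ℝ} (hρ : 0 < ρ) (w : ℕ → EuclideanSpace ℝ (Fin p) → ℝ) (C : ℝ)
    (hwC : ∀ᶠ k in atTop, ∀ u, |w k u| ≤ C * (1 + ‖u‖ ^ 2)) :
    Tendsto (fun k => r k ^ p * Real.exp (-(1 / 2) * quad J⁻¹ (Z k)) *
      ∫ θ in Θ \ Metric.closedBall θs ρ, w k (localCoord θs J (r k) (Z k) θ) * (prior θ * G k θ))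
      atTop (𝓝 0) := by
  obtain ⟨D, hD0, hD⟩ := S.exists_localCoord_le
  obtain ⟨η, hη, hsep⟩ := S.separated ρ hρ
  set I := ∫ θ in Θ, ‖prior θ‖
  have hlim : Tendsto (fun k => |C| * (1 + D ^ 2) * 2 * I *
      (r k ^ ((p + 2 : ℕ) : ℝ) * Real.exp (-η * r k))) atTop (𝓝 0) := by
    simpa using ((tendsto_rpow_mul_exp_neg_mul_atTop_nhds_zero ((p + 2 : ℕ) : ℝ) η hη).comp
      S.tendsto_r).const_mul (|C| * (1 + D ^ 2) * 2 * I)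
  refine squeeze_zero_norm' ?_ hlim
  filter_upwards [hwC, hsep, S.approx 1 one_pos, S.tendsto_r.eventually_ge_atTop 1] with
    k hwk hsepk happ hr
  have hr0 : 0 ≤ r k := by linarith
  have hq : 0 ≤ quad J⁻¹ (Z k) := by
    simpa [quad] using S.posDef.inv.posSemidef.dotProduct_mulVec_nonneg (Z k).ofLp
  have he : Real.exp (-(1 / 2) * quad J⁻¹ (Z k)) ≤ 1 := Real.exp_le_one_iff.2 (by linarith)
  set M := |C| * (1 + D ^ 2) * r k ^ 2 * (2 * Real.exp (-η * r k)) with hM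
  have hM0 : 0 ≤ M := by positivity
  have hsub : Θ \ Metric.closedBall θs ρ ⊆ Θ := sdiff_subset
  have hint : ‖∫ θ in Θ \ Metric.closedBall θs ρ,
      w k (localCoord θs J (r k) (Z k) θ) * (prior θ * G k θ)‖ ≤ M * I := by
    have hpn : IntegrableOn (fun θ => ‖prior θ‖) Θ := S.integrable_prior.norm
    calc _ ≤ ∫ θ in Θ \ Metric.closedBall θs ρ, M * ‖prior θ‖ := by
          refine norm_integral_le_of_norm_le ((hpn.mono_set hsub).const_mul M) ?_
          refine (ae_restrict_iff' (S.compact.measurableSet.diff measurableSet_closedBall)).2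
            (ae_of_all _ fun θ hθ => ?_)
          have h1 : |w k (localCoord θs J (r k) (Z k) θ)| ≤ |C| * (1 + D ^ 2) * r k ^ 2 := by
            refine (hwk _).trans ?_
            have h2 := hD k θ hθ.1 hr
            have h3 : ‖localCoord θs J (r k) (Z k) θ‖ ^ 2 ≤ (D * r k) ^ 2 := by gcongr
            have h4 : 1 ≤ r k ^ 2 := one_le_pow₀ hr
            rw [mul_assoc]
            refine mul_le_mul (le_abs_self C) ?_ (by positivity) (abs_nonneg _)
            nlinarith
          -- Since `1 ≤ r k`, the exponent may be weakened from `r²` to `r`, which matches the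
          -- standard limit of a power times an exponential.
          have hL : L k θ ≤ -η * r k := by
            refine (hsepk θ hθ.1 (by simpa using (not_le.1 (show ¬ dist θ θs ≤ ρ from hθ.2)).le)).trans ?_
            nlinarith [mul_nonneg hη.le (mul_nonneg hr0 (sub_nonneg.2 hr))]
          have hG : |G k θ| ≤ 2 * Real.exp (-η * r k) := by
            have h4 := happ θ hθ.1
            have h6 := abs_sub_abs_le_abs_sub (G k θ) (Real.exp (L k θ))
            rw [abs_of_pos (Real.exp_pos (L k θ))] at h6
            have h7 := Real.exp_le_exp.2 hL
            linarith
          rw [norm_mul, norm_mul]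
          calc _ ≤ |C| * (1 + D ^ 2) * r k ^ 2 * (‖prior θ‖ * (2 * Real.exp (-η * r k))) := by
                gcongr
                · exact h1
                · exact hG
            _ = _ := by rw [hM]; ring
      _ ≤ ∫ θ in Θ, M * ‖prior θ‖ := by
          refine setIntegral_mono_set (hpn.const_mul M) (ae_of_all _ fun θ => by positivity)
            hsub.eventuallyLE
      _ = M * I := integral_const_mul _ _
  rw [norm_mul, norm_mul, Real.norm_of_nonneg (by positivity : 0 ≤ r k ^ p),
    Real.norm_of_nonneg (Real.exp_nonneg _)]
  calc _ ≤ r k ^ p * 1 * (M * I) := by gcongr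
    _ = _ := by
      rw [Real.rpow_natCast, hM]
      ring

/-- Laplace approximation of the unnormalized posterior integrals. -/
theorem tendsto_integral (w : ℕ → EuclideanSpace ℝ (Fin p) → ℝ) (w' : EuclideanSpace ℝ (Fin p) → ℝ)
    (C : ℝ) (hw : ∀ k, Measurable (w k)) (hwC : ∀ᶠ k in atTop, ∀ u, |w k u| ≤ C * (1 + ‖u‖ ^ 2))
    (hlim : ∀ᵐ u, Tendsto (fun k => w k u) atTop (𝓝 (w' u))) :
    Tendsto (fun k => r k ^ p * Real.exp (-(1 / 2) * quad J⁻¹ (Z k)) *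
      ∫ θ in Θ, w k (localCoord θs J (r k) (Z k) θ) * (prior θ * G k θ)) atTop
      (𝓝 (prior θs * ∫ u, w' u * Real.exp (-(1 / 2) * quad J u))) := by
  obtain ⟨ρ₀, hρ₀, hnear⟩ := S.tendsto_near
  obtain ⟨ρ₂, hρ₂, hρ₂'⟩ := Metric.mem_nhds_iff.1 (mem_interior_iff_mem_nhds.1 S.mem_interior)
  set ρ := min ρ₀ (ρ₂ / 2)
  have hρ : 0 < ρ := by positivity
  have hsub : Metric.closedBall θs ρ ⊆ Θ := fun x hx => hρ₂' (by
    have h1 : dist x θs ≤ ρ := hx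
    have h2 : ρ ≤ ρ₂ / 2 := min_le_right _ _
    rw [Metric.mem_ball]
    linarith)
  have h := (hnear ρ hρ (min_le_left _ _) w w' C hw hwC hlim).add (S.tendsto_far hρ w C hwC)
  rw [add_zero] at h
  refine h.congr' ?_
  obtain ⟨D, hD0, hD⟩ := S.exists_localCoord_le
  filter_upwards [S.eventually_integrableOn, hwC, S.tendsto_r.eventually_ge_atTop 1] with
    k hk hwk hr
  have hi := hk (fun θ => w k (localCoord θs J (r k) (Z k) θ))
    ((hw k).comp (measurable_localCoord _ _ _ _)) ⟨|C| * (1 + (D * r k) ^ 2), fun θ hθ => by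
      refine (hwk _).trans ?_
      have h2 := hD k θ hθ hr
      have h3 : ‖localCoord θs J (r k) (Z k) θ‖ ^ 2 ≤ (D * r k) ^ 2 := by gcongr
      gcongr
      exact le_abs_self C⟩
  rw [← mul_add]
  congr 1
  have h2 := setIntegral_union (s := Metric.closedBall θs ρ) (t := Θ \ Metric.closedBall θs ρ) (μ := volume)
    (f := fun θ => w k (localCoord θs J (r k) (Z k) θ) * (prior θ * G k θ)) disjoint_sdiff_right
    (S.compact.measurableSet.diff measurableSet_closedBall) (hi.mono_set hsub)
    (hi.mono_set sdiff_subset)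
  rw [union_sdiff_cancel hsub] at h2
  exact h2.symm

/-- With weight one, the rescaled normalizing constant tends to a positive multiple of `prior θs`.
-/
theorem eventually_integral_pos : ∀ᶠ k in atTop, 0 < ∫ θ in Θ, prior θ * G k θ := by
  obtain ⟨c, hc, hcint⟩ := exists_integral_gaussian S.posDef
  have h := S.tendsto_integral (fun _ _ => 1) (fun _ => 1) 1 (fun _ => measurable_const)
    (Eventually.of_forall fun k u => by simp) (ae_of_all _ fun u => tendsto_const_nhds)
  have hpos := S.prior_pos
  rw [hcint] at h
  simp only [one_mul, integral_const, probReal_univ, smul_eq_mul, mul_one] at h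
  filter_upwards [h.eventually_const_lt (mul_pos hpos hc), S.tendsto_r.eventually_gt_atTop 0] with
    k hk hr
  exact (pos_iff_pos_of_mul_pos hk).1 (by positivity)

/-- Posterior expectations converge to Gaussian expectations. -/
theorem tendsto_posterior (w : ℕ → EuclideanSpace ℝ (Fin p) → ℝ)
    (w' : EuclideanSpace ℝ (Fin p) → ℝ)
    (C : ℝ) (hw : ∀ k, Measurable (w k)) (hwC : ∀ᶠ k in atTop, ∀ u, |w k u| ≤ C * (1 + ‖u‖ ^ 2))
    (hlim : ∀ᵐ u, Tendsto (fun k => w k u) atTop (𝓝 (w' u))) :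
    Tendsto (fun k => (∫ θ in Θ, w k (localCoord θs J (r k) (Z k) θ) * (prior θ * G k θ)) /
      ∫ θ in Θ, prior θ * G k θ) atTop (𝓝 (∫ u, w' u ∂(multivariateGaussian 0 J⁻¹))) := by
  obtain ⟨c, hc, hcint⟩ := exists_integral_gaussian S.posDef
  have h1 := S.tendsto_integral w w' C hw hwC hlim
  have h := S.tendsto_integral (fun _ _ => 1) (fun _ => 1) 1 (fun _ => measurable_const)
    (Eventually.of_forall fun k u => by simp) (ae_of_all _ fun u => tendsto_const_nhds)
  have hpos := S.prior_pos
  rw [hcint] at h h1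
  simp only [one_mul, integral_const, probReal_univ, smul_eq_mul, mul_one] at h
  have h2 := h1.div h (by positivity)
  have h3 : prior θs * (c * ∫ u, w' u ∂(multivariateGaussian 0 J⁻¹)) / (prior θs * c) =
      ∫ u, w' u ∂(multivariateGaussian 0 J⁻¹) := by field_simp
  rw [h3] at h2
  refine h2.congr' ?_
  filter_upwards [S.tendsto_r.eventually_gt_atTop 0] with k hr
  exact mul_div_mul_left _ _ (by positivity)

end LaplaceSetting
end BSL

/-! ### Posterior mean, covariance and credible sets along a deterministic sequence. -/

namespace BSL

/-- A level set of a nonzero linear functional is a translate of a proper subspace. Hence boundaries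
of credible slabs do not affect limits. -/
theorem ae_dotProduct_ne {p : ℕ} {a : EuclideanSpace ℝ (Fin p)} (ha : a ≠ 0) (c : ℝ) :
    ∀ᵐ u : EuclideanSpace ℝ (Fin p), a.ofLp ⬝ᵥ u.ofLp ≠ c := by
  have hdot : ∀ u : EuclideanSpace ℝ (Fin p), a.ofLp ⬝ᵥ u.ofLp = inner ℝ a u := fun u => by
    simp [EuclideanSpace.inner_eq_star_dotProduct, dotProduct_comm]
  have haa : inner ℝ a a ≠ 0 := by simpa using ha
  set K : Submodule ℝ (EuclideanSpace ℝ (Fin p)) :=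
    LinearMap.ker (innerSL ℝ a : EuclideanSpace ℝ (Fin p) →ₗ[ℝ] ℝ)
  have hK : K ≠ ⊤ := by
    intro h
    have : a ∈ K := h ▸ Submodule.mem_top
    exact haa (by simpa [K] using this)
  have h0 := Measure.addHaar_submodule (volume : Measure (EuclideanSpace ℝ (Fin p))) K hK
  have h1 := measure_preimage_add_right (volume : Measure (EuclideanSpace ℝ (Fin p)))
    (-((c / inner ℝ a a) • a)) K
  rw [h0] at h1
  rw [ae_iff]
  refine measure_mono_null (fun u hu => ?_) h1
  have hu' : inner ℝ a u = c := by rw [← hdot]; simpa using hu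
  show u + -((c / inner ℝ a a) • a) ∈ K
  rw [LinearMap.mem_ker]
  show inner ℝ a (u + -((c / inner ℝ a a) • a)) = 0
  rw [inner_add_right, inner_neg_right, inner_smul_right, hu']
  field_simp
  ring

theorem abs_coord_le {p : ℕ} (u : EuclideanSpace ℝ (Fin p)) (i : Fin p) : |u i| ≤ ‖u‖ :=
  PiLp.norm_apply_le u i

theorem localCoord_sub_localCoord {p : ℕ} (θs : EuclideanSpace ℝ (Fin p))
    (J : Matrix (Fin p) (Fin p) ℝ) (r : ℝ) (Z θ θ' : EuclideanSpace ℝ (Fin p)) :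
    localCoord θs J r Z θ - localCoord θs J r Z θ' = r • (θ - θ') := by
  simp only [localCoord]
  module

namespace LaplaceSetting

variable {p : ℕ} {Θ : Set (EuclideanSpace ℝ (Fin p))}
    {prior : EuclideanSpace ℝ (Fin p) → ℝ} {θs : EuclideanSpace ℝ (Fin p)}
    {J : Matrix (Fin p) (Fin p) ℝ} {r : ℕ → ℝ} {Z : ℕ → EuclideanSpace ℝ (Fin p)}
    {L G : ℕ → EuclideanSpace ℝ (Fin p) → ℝ} (S : LaplaceSetting Θ prior θs J r Z L G)
    {q : ℕ → EuclideanSpace ℝ (Fin p) → ℝ}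
    (hq : ∀ᶠ k in atTop, ∀ θ, q k θ = prior θ * G k θ / ∫ θ' in Θ, prior θ' * G k θ')

include S hq

theorem tendsto_expectation (w : ℕ → EuclideanSpace ℝ (Fin p) → ℝ)
    (w' : EuclideanSpace ℝ (Fin p) → ℝ)
    (C : ℝ) (hw : ∀ k, Measurable (w k)) (hwC : ∀ᶠ k in atTop, ∀ u, |w k u| ≤ C * (1 + ‖u‖ ^ 2))
    (hlim : ∀ᵐ u, Tendsto (fun k => w k u) atTop (𝓝 (w' u))) :
    Tendsto (fun k => ∫ θ in Θ, q k θ * w k (localCoord θs J (r k) (Z k) θ)) atTop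
      (𝓝 (∫ u, w' u ∂(multivariateGaussian 0 J⁻¹))) := by
  refine (S.tendsto_posterior w w' C hw hwC hlim).congr' ?_
  filter_upwards [hq] with k hk
  rw [← integral_div]
  congr with θ
  rw [hk]
  ring

theorem eventually_density : ∀ᶠ k in atTop, (∫ θ in Θ, q k θ = 1) ∧
    ∀ w : EuclideanSpace ℝ (Fin p) → ℝ, Continuous w → IntegrableOn (fun θ => q k θ * w θ) Θ := by
  filter_upwards [hq, S.eventually_integrableOn, S.eventually_integral_pos] with k hk hint hpos
  constructor
  · simp_rw [hk]
    rw [integral_div, div_self hpos.ne']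
  · intro w hw
    have h := (hint w hw.measurable (S.compact.exists_bound_of_continuousOn hw.continuousOn)).div_const
      (∫ θ' in Θ, prior θ' * G k θ')
    refine h.congr (ae_of_all _ fun θ => ?_)
    simp only [hk]
    ring

/-- The local coordinate is affine and the posterior integrates to one, so expectation commutes with
it. -/
theorem integral_localCoord : ∀ᶠ k in atTop, ∀ i,
    (localCoord θs J (r k) (Z k) (∫ θ in Θ, q k θ • θ)) i =
      ∫ θ in Θ, q k θ * localCoord θs J (r k) (Z k) θ i := by
  filter_upwards [S.eventually_density hq] with k ⟨h1, hint⟩ i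
  have hvec : IntegrableOn (fun θ => q k θ • θ) Θ := by
    have hn : IntegrableOn (fun θ => q k θ * ‖θ‖) Θ := hint _ continuous_norm
    have hq1 : IntegrableOn (q k) Θ := by simpa using hint (fun _ => 1) continuous_const
    refine hn.norm.mono' (hq1.aestronglyMeasurable.smul aestronglyMeasurable_id) ?_
    exact ae_of_all _ fun θ => by simp [norm_smul]
  have hcoord : (∫ θ in Θ, q k θ • θ) i = ∫ θ in Θ, q k θ * θ i := by
    have := (EuclideanSpace.proj (𝕜 := ℝ) i).integral_comp_comm hvec
    simpa using this.symm
  have hi : IntegrableOn (fun θ : EuclideanSpace ℝ (Fin p) => q k θ * θ i) Θ :=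
    hint _ (by fun_prop)
  have hc : IntegrableOn (q k) Θ := by simpa using hint (fun _ => 1) continuous_const
  set m := Matrix.toEuclideanCLM (𝕜 := ℝ) J⁻¹ (Z k)
  have h2 : ∀ θ : EuclideanSpace ℝ (Fin p), q k θ * localCoord θs J (r k) (Z k) θ i =
      r k * (q k θ * θ i) - (r k * θs i + m i) * q k θ := fun θ => by
    simp only [localCoord, PiLp.sub_apply, PiLp.smul_apply, smul_eq_mul]
    ring
  simp_rw [h2]
  rw [integral_sub (hi.const_mul _) (hc.const_mul _), integral_const_mul, integral_const_mul, h1,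
    ← hcoord]
  simp only [localCoord, PiLp.sub_apply, PiLp.smul_apply, smul_eq_mul]
  ring

/-- The posterior mean is asymptotically equivalent to `θs + J⁻¹ Z / r`. -/
theorem tendsto_mean :
    Tendsto (fun k => localCoord θs J (r k) (Z k) (∫ θ in Θ, q k θ • θ)) atTop (𝓝 0) := by
  have h : ∀ i, Tendsto (fun k => (localCoord θs J (r k) (Z k) (∫ θ in Θ, q k θ • θ)) i) atTop
      (𝓝 0) := by
    intro i
    have h1 := S.tendsto_expectation hq (fun _ u => u i) (fun u => u i) 1
      (fun _ => by fun_prop) (Eventually.of_forall fun k u => by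
        have := abs_coord_le u i
        nlinarith [sq_nonneg (‖u‖ - 1), norm_nonneg u]) (ae_of_all _ fun u => tendsto_const_nhds)
    rw [integral_coord_multivariateGaussian] at h1
    refine h1.congr' ?_
    filter_upwards [S.integral_localCoord hq] with k hk
    exact (hk i).symm
  have h2 := tendsto_pi_nhds.2 h
  have h3 := ((PiLp.continuous_toLp 2 (fun _ : Fin p => ℝ)).tendsto _).comp h2
  exact h3

/-- The rescaled posterior covariance converges to `J⁻¹`. -/
theorem tendsto_cov (i j : Fin p) :
    Tendsto (fun k => r k ^ 2 * ∫ θ in Θ, q k θ * ((θ i - (∫ θ in Θ, q k θ • θ) i) *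
      (θ j - (∫ θ in Θ, q k θ • θ) j))) atTop (𝓝 (J⁻¹ i j)) := by
  set e : ℕ → EuclideanSpace ℝ (Fin p) :=
    fun k => localCoord θs J (r k) (Z k) (∫ θ in Θ, q k θ • θ) with he
  have hlim : Tendsto e atTop (𝓝 0) := S.tendsto_mean hq
  have hcoord : ∀ i, Tendsto (fun k => e k i) atTop (𝓝 0) := fun i => by
    have := ((EuclideanSpace.proj (𝕜 := ℝ) i : EuclideanSpace ℝ (Fin p) →L[ℝ] ℝ).continuous.tendsto 0).comp hlim
    simpa [Function.comp_def] using this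
  -- Centring at the posterior mean becomes a vanishing shift `e k` in the weight. The constant `2`
  -- comes from `(‖u‖ + 1)² ≤ 2 (1 + ‖u‖²)`.
  have h1 := S.tendsto_expectation hq (fun k u => (u i - e k i) * (u j - e k j))
    (fun u => u i * u j) 2 (fun _ => by fun_prop) (by
      have hev : ∀ᶠ k in atTop, ‖e k‖ < 1 := hlim.norm.eventually_lt_const (by simp)
      filter_upwards [hev] with k hk u
      have hb : ∀ i, |u i - e k i| ≤ ‖u‖ + 1 := fun i => by
        have h2 := abs_coord_le u i
        have h3 := abs_coord_le (e k) i
        have h4 := abs_sub (u i) (e k i)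
        linarith
      rw [abs_mul]
      calc _ ≤ (‖u‖ + 1) * (‖u‖ + 1) := by gcongr <;> exact hb _
        _ ≤ _ := by nlinarith [sq_nonneg (‖u‖ - 1)])
    (ae_of_all _ fun u => by
      have h2 := ((hcoord i).const_sub (u i)).mul ((hcoord j).const_sub (u j))
      simpa using h2)
  rw [integral_coord_mul_coord_multivariateGaussian S.posDef.inv.posSemidef] at h1
  refine h1.congr fun k => ?_
  rw [← integral_const_mul]
  congr with θ
  have h2 : ∀ i, localCoord θs J (r k) (Z k) θ i - e k i =
      r k * (θ i - (∫ θ in Θ, q k θ • θ) i) := fun i => by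
    have := congrArg (fun v => v i) (localCoord_sub_localCoord θs J (r k) (Z k) θ (∫ θ in Θ, q k θ • θ))
    simpa using this
  rw [h2, h2]
  ring

/-- The posterior probability of a symmetric credible set for a linear functional. -/
theorem tendsto_credible (a : EuclideanSpace ℝ (Fin p)) {z : ℝ} (hz : 0 < z)
    (cov : ℕ → Matrix (Fin p) (Fin p) ℝ)
    (hcov : ∀ i j, Tendsto (fun k => r k ^ 2 * cov k i j) atTop (𝓝 (J⁻¹ i j))) :
    Tendsto (fun k => ∫ θ in Θ ∩ {θ | |a.ofLp ⬝ᵥ (θ - ∫ θ in Θ, q k θ • θ).ofLp| ≤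
      z * √(a.ofLp ⬝ᵥ cov k *ᵥ a.ofLp)}, q k θ) atTop
      (𝓝 (normalMass (a.ofLp ⬝ᵥ J⁻¹ *ᵥ a.ofLp) (z * √(a.ofLp ⬝ᵥ J⁻¹ *ᵥ a.ofLp)))) := by
  set e : ℕ → EuclideanSpace ℝ (Fin p) :=
    fun k => localCoord θs J (r k) (Z k) (∫ θ in Θ, q k θ • θ) with he
  have hlim : Tendsto e atTop (𝓝 0) := S.tendsto_mean hq
  set σ := a.ofLp ⬝ᵥ J⁻¹ *ᵥ a.ofLp with hσ
  have hcont : Continuous fun u : EuclideanSpace ℝ (Fin p) => a.ofLp ⬝ᵥ u.ofLp := by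
    unfold dotProduct; fun_prop
  set R : ℕ → ℝ := fun k => r k * (z * √(a.ofLp ⬝ᵥ cov k *ᵥ a.ofLp)) with hR
  have hRlim : Tendsto R atTop (𝓝 (z * √σ)) := by
    have h1 : Tendsto (fun k => r k ^ 2 * (a.ofLp ⬝ᵥ cov k *ᵥ a.ofLp)) atTop (𝓝 σ) := by
      simp only [dotProduct, Matrix.mulVec, Finset.mul_sum, hσ]
      refine tendsto_finsetSum _ fun i _ => tendsto_finsetSum _ fun j _ => ?_
      have := ((hcov i j).mul_const (a.ofLp j)).const_mul (a.ofLp i)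
      refine this.congr fun k => by ring
    have h2 := (h1.sqrt).const_mul z
    refine h2.congr' ?_
    filter_upwards [S.tendsto_r.eventually_gt_atTop 0] with k hr
    rw [Real.sqrt_mul (by positivity), Real.sqrt_sq hr.le, hR]
    ring
  set A : ℕ → Set (EuclideanSpace ℝ (Fin p)) := fun k => {u | |a.ofLp ⬝ᵥ (u - e k).ofLp| ≤ R k}
  have hAm : ∀ k, MeasurableSet (A k) := fun k =>
    (isClosed_le (by exact (hcont.comp (continuous_id.sub continuous_const)).abs)
      continuous_const).measurableSet
  set A' : Set (EuclideanSpace ℝ (Fin p)) := {u | |a.ofLp ⬝ᵥ u.ofLp| ≤ z * √σ}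
  have hA'm : MeasurableSet A' := (isClosed_le hcont.abs continuous_const).measurableSet
  -- Centre and half-width of the slabs converge, so their indicators converge off the two bounding
  -- hyperplanes. For `a = 0` every slab is the whole space.
  have hpt : ∀ᵐ u, Tendsto (fun k => (A k).indicator (fun _ => (1 : ℝ)) u) atTop
      (𝓝 (A'.indicator (fun _ => (1 : ℝ)) u)) := by
    rcases eq_or_ne a 0 with rfl | ha
    · refine ae_of_all _ fun u => ?_
      have h1 : ∀ k, u ∈ A k := fun k => by simp [A, hR]
      have h2 : u ∈ A' := by simp [A', hσ]
      simp [h1, h2]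
    filter_upwards [ae_dotProduct_ne ha (z * √σ), ae_dotProduct_ne ha (-(z * √σ))] with u h1 h2
    have h3 : Tendsto (fun k => |a.ofLp ⬝ᵥ (u - e k).ofLp|) atTop (𝓝 |a.ofLp ⬝ᵥ u.ofLp|) := by
      have h4 : Tendsto (fun k => u - e k) atTop (𝓝 u) := by simpa using hlim.const_sub u
      exact ((hcont.tendsto u).comp h4).abs
    have hz0 : 0 ≤ z * √σ := by positivity
    rcases lt_trichotomy |a.ofLp ⬝ᵥ u.ofLp| (z * √σ) with hlt | heq | hgt
    · refine tendsto_const_nhds.congr' ?_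
      filter_upwards [h3.eventually_lt hRlim hlt] with k hk
      rw [indicator_of_mem (show u ∈ A k from hk.le), indicator_of_mem (show u ∈ A' from hlt.le)]
    · rcases (abs_eq hz0).1 heq with h | h
      · exact absurd h h1
      · exact absurd h h2
    · refine tendsto_const_nhds.congr' ?_
      filter_upwards [hRlim.eventually_lt h3 hgt] with k hk
      rw [indicator_of_notMem (show u ∉ A k from not_le.2 hk),
        indicator_of_notMem (show u ∉ A' from not_le.2 hgt)]
  have h1 := S.tendsto_expectation hq (fun k => (A k).indicator fun _ => 1)
    (A'.indicator fun _ => 1) 1 (fun k => measurable_const.indicator (hAm k))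
    (Eventually.of_forall fun k u => by
      by_cases hu : u ∈ A k <;> (simp [hu]; try positivity)) hpt
  have h2 : ∫ u, A'.indicator (fun _ => (1 : ℝ)) u ∂(multivariateGaussian 0 J⁻¹) =
      normalMass σ (z * √σ) := by
    rw [integral_indicator hA'm, setIntegral_const, smul_eq_mul, mul_one, normalMass, hσ,
      ← map_dotProduct_multivariateGaussian S.posDef.inv.posSemidef,
      measureReal_def, measureReal_def, Measure.map_apply hcont.measurable measurableSet_Icc]
    congr 2
    ext u
    simp [A', abs_le, hσ]
  rw [h2] at h1
  refine h1.congr' ?_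
  filter_upwards [S.tendsto_r.eventually_gt_atTop 0] with k hr
  set B : Set (EuclideanSpace ℝ (Fin p)) := {θ | |a.ofLp ⬝ᵥ (θ - ∫ θ in Θ, q k θ • θ).ofLp| ≤
      z * √(a.ofLp ⬝ᵥ cov k *ᵥ a.ofLp)}
  have hBm : MeasurableSet B :=
    (isClosed_le (by exact (hcont.comp (continuous_id.sub continuous_const)).abs)
      continuous_const).measurableSet
  rw [← setIntegral_indicator hBm]
  congr with θ
  have h3 : localCoord θs J (r k) (Z k) θ ∈ A k ↔ θ ∈ B := by
    show |a.ofLp ⬝ᵥ (localCoord θs J (r k) (Z k) θ - e k).ofLp| ≤ R k ↔ _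
    rw [he, localCoord_sub_localCoord, WithLp.ofLp_smul, dotProduct_smul, smul_eq_mul, abs_mul,
      abs_of_pos hr, hR]
    exact mul_le_mul_iff_right₀ hr
  by_cases hθ : θ ∈ B
  · simp [hθ, h3.2 hθ]
  · simp [hθ, mt h3.1 hθ]

end LaplaceSetting
end BSL

/-! ### Measurability of the posterior and its moments as functions of the data. -/

namespace BSL

section Measurability

variable {α : Type*} [MeasurableSpace α] {d : ℕ}

theorem measurable_det {k : ℕ} {A : α → Matrix (Fin k) (Fin k) ℝ}
    (hA : ∀ i j, Measurable fun a => A a i j) : Measurable fun a => (A a).det := by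
  simp only [Matrix.det_apply]
  refine Finset.measurable_sum _ fun σ _ => ?_
  exact (Finset.measurable_prod _ fun i _ => hA _ _).const_smul _

/-- Cramer's rule writes entries of the inverse through determinants; the convention `0⁻¹ = 0` keeps
the formula valid for singular matrices. -/
theorem measurable_inv_apply {A : α → Matrix (Fin d) (Fin d) ℝ}
    (hA : ∀ i j, Measurable fun a => A a i j) (i j : Fin d) :
    Measurable fun a => (A a)⁻¹ i j := by
  have h : ∀ a, (A a)⁻¹ i j = (A a).det⁻¹ * ((A a).updateRow j (Pi.single i 1)).det := fun a => by
    rw [Matrix.inv_def, Matrix.smul_apply, Matrix.adjugate_apply, Ring.inverse_eq_inv', smul_eq_mul]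
  simp_rw [h]
  refine (measurable_det hA).inv.mul (measurable_det fun k l => ?_)
  by_cases hk : k = j
  · subst hk; simp
  · simpa [Matrix.updateRow_ne hk] using hA k l

theorem measurable_normalDensity {x μ : α → EuclideanSpace ℝ (Fin d)}
    {A : α → Matrix (Fin d) (Fin d) ℝ} (hx : Measurable x) (hμ : Measurable μ)
    (hA : ∀ i j, Measurable fun a => A a i j) :
    Measurable fun a => normalDensity (x a) (μ a) (A a) := by
  have h := measurable_det hA
  have h2 : Measurable fun a => (x a - μ a).ofLp ⬝ᵥ (A a)⁻¹ *ᵥ (x a - μ a).ofLp := by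
    simp only [dotProduct, Matrix.mulVec]
    refine Finset.measurable_sum _ fun i _ => ?_
    refine Measurable.mul (by fun_prop) (Finset.measurable_sum _ fun j _ => ?_)
    exact (measurable_inv_apply hA i j).mul (by fun_prop)
  unfold normalDensity
  fun_prop

/-- It suffices to test on boxes, where the product measure is a finite product of measurable
functions. -/
theorem measurable_pi_kernel {β : Type*} [MeasurableSpace β] (κ : Kernel α β) [IsMarkovKernel κ]
    (m : ℕ) : Measurable fun a => Measure.pi fun _ : Fin m => κ a := by
  refine Measurable.measure_of_isPiSystem_of_isProbabilityMeasure generateFrom_pi.symm isPiSystem_pi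
    ?_
  rintro _ ⟨s, hs, rfl⟩
  simp only [Measure.pi_pi]
  exact Finset.measurable_prod _ fun i _ => Kernel.measurable_coe κ (hs i (mem_univ i))

end Measurability

namespace Experiment

variable {p d : ℕ} (E : Experiment p d)

/-- Joint measurability is what allows integrating over the parameter while keeping measurability in
the data. The simulation law is viewed as a kernel that ignores the observed summary. -/
theorem measurable_estSL (n m : ℕ) :
    Measurable fun x : EuclideanSpace ℝ (Fin d) × EuclideanSpace ℝ (Fin p) =>
      E.estSL n m x.1 x.2 := by
  let κ : Kernel (EuclideanSpace ℝ (Fin d) × EuclideanSpace ℝ (Fin p)) (Fin m → Fin n → ℝ) :=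
    ⟨fun x => Measure.pi fun _ : Fin m => E.P n x.2,
      (measurable_pi_kernel (E.P n) m).comp measurable_snd⟩
  have hκ : IsMarkovKernel κ := ⟨fun x => by
    show IsProbabilityMeasure (Measure.pi fun _ : Fin m => E.P n x.2)
    infer_instance⟩
  have hS := E.measurable_S n
  have hmean : Measurable fun x : (EuclideanSpace ℝ (Fin d) × EuclideanSpace ℝ (Fin p)) ×
      (Fin m → Fin n → ℝ) => sampleMean fun k => E.S n (x.2 k) := by
    have hsum : Measurable fun x : (EuclideanSpace ℝ (Fin d) × EuclideanSpace ℝ (Fin p)) ×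
        (Fin m → Fin n → ℝ) => ∑ k, E.S n (x.2 k) :=
      Finset.measurable_sum _ fun k _ => hS.comp (by fun_prop)
    exact hsum.const_smul (m : ℝ)⁻¹
  have h : Measurable fun x : (EuclideanSpace ℝ (Fin d) × EuclideanSpace ℝ (Fin p)) ×
      (Fin m → Fin n → ℝ) => normalDensity x.1.1 (sampleMean fun k => E.S n (x.2 k))
        (sampleCov fun k => E.S n (x.2 k)) := by
    refine measurable_normalDensity (by fun_prop) hmean fun i j => ?_
    simp only [sampleCov, Matrix.of_apply]
    refine measurable_const.mul (Finset.measurable_sum _ fun k _ => ?_)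
    have hk : Measurable fun x : (EuclideanSpace ℝ (Fin d) × EuclideanSpace ℝ (Fin p)) ×
      (Fin m → Fin n → ℝ) => E.S n (x.2 k) := hS.comp (by fun_prop)
    fun_prop
  exact (h.stronglyMeasurable.integral_kernel_prod_right' (κ := κ)).measurable

theorem measurable_posterior (n m : ℕ) :
    Measurable fun x : (Fin n → ℝ) × EuclideanSpace ℝ (Fin p) => E.posterior n m x.1 x.2 := by
  have h1 : Measurable fun x : (Fin n → ℝ) × EuclideanSpace ℝ (Fin p) =>
      E.prior x.2 * E.estSL n m (E.S n x.1) x.2 :=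
    (E.measurable_prior.comp measurable_snd).mul
      ((E.measurable_estSL n m).comp (((E.measurable_S n).comp measurable_fst).prodMk
        measurable_snd))
  have h2 : Measurable fun y : Fin n → ℝ =>
      ∫ θ' in E.Θ, E.prior θ' * E.estSL n m (E.S n y) θ' :=
    h1.stronglyMeasurable.integral_prod_right'.measurable
  exact h1.div (h2.comp measurable_fst)

theorem measurable_posteriorMean (n m : ℕ) : Measurable (E.posteriorMean n m) := by
  have h : Measurable fun x : (Fin n → ℝ) × EuclideanSpace ℝ (Fin p) =>
      E.posterior n m x.1 x.2 • x.2 := (E.measurable_posterior n m).smul measurable_snd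
  exact h.stronglyMeasurable.integral_prod_right'.measurable

theorem measurable_posteriorCov (n m : ℕ) (i j : Fin p) :
    Measurable fun y => E.posteriorCov n m y i j := by
  have hm := E.measurable_posteriorMean n m
  have h : Measurable fun x : (Fin n → ℝ) × EuclideanSpace ℝ (Fin p) =>
      E.posterior n m x.1 x.2 * ((x.2 i - E.posteriorMean n m x.1 i) *
        (x.2 j - E.posteriorMean n m x.1 j)) := by
    have h1 := E.measurable_posterior n m
    have h2 : Measurable fun x : (Fin n → ℝ) × EuclideanSpace ℝ (Fin p) =>
        E.posteriorMean n m x.1 := hm.comp measurable_fst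
    fun_prop
  exact h.stronglyMeasurable.integral_prod_right'.measurable

end Experiment
end BSL

/-! ### Uniform limit of the log likelihood ratio, and separation away from `θs`. -/

namespace BSL

/-- Joint convergence in the index and the point composes directly with continuous operations such
as determinant and inverse. On a compact set with continuous limit it is equivalent to uniform
convergence; the next lemma is the way back. -/
theorem tendsto_uncurry_of_tendstoUniformlyOn {X Y : Type*} [TopologicalSpace X]
    [PseudoMetricSpace Y] {F : ℕ → X → Y} {f : X → Y} {K : Set X}
    (h : TendstoUniformlyOn F f atTop K) (hf : ContinuousOn f K) {x : X} (hx : x ∈ K) :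
    Tendsto (fun q : ℕ × X => F q.1 q.2) (atTop ×ˢ 𝓝[K] x) (𝓝 (f x)) := by
  rw [Metric.tendsto_nhds]
  intro ε hε
  have h1 := Metric.tendstoUniformlyOn_iff.1 h (ε / 2) (half_pos hε)
  have h2 : ∀ᶠ y in 𝓝[K] x, dist (f y) (f x) < ε / 2 ∧ y ∈ K :=
    ((hf x hx).eventually (Metric.ball_mem_nhds _ (half_pos hε))).and self_mem_nhdsWithin
  filter_upwards [h1.prod_mk h2] with q hq
  calc dist (F q.1 q.2) (f x) ≤ dist (F q.1 q.2) (f q.2) + dist (f q.2) (f x) :=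
        dist_triangle _ _ _
    _ < ε / 2 + ε / 2 := by
        gcongr
        · rw [dist_comm]; exact hq.1 _ hq.2.2
        · exact hq.2.1
    _ = ε := add_halves ε

theorem tendstoUniformlyOn_of_tendsto_uncurry {X Y : Type*} [TopologicalSpace X]
    [PseudoMetricSpace Y] {F : ℕ → X → Y} {f : X → Y} {K : Set X} (hK : IsCompact K)
    (hf : ContinuousOn f K)
    (h : ∀ x ∈ K, Tendsto (fun q : ℕ × X => F q.1 q.2) (atTop ×ˢ 𝓝[K] x) (𝓝 (f x))) :
    TendstoUniformlyOn F f atTop K := by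
  rw [← tendstoLocallyUniformlyOn_iff_tendstoUniformlyOn_of_compact hK,
    tendstoLocallyUniformlyOn_iff_forall_tendsto]
  intro x hx
  have h1 : Tendsto (fun q : ℕ × X => f q.2) (atTop ×ˢ 𝓝[K] x) (𝓝 (f x)) :=
    (hf x hx).tendsto.comp tendsto_snd
  have h2 := h1.prodMk_nhds (h x hx)
  have h3 : 𝓝 (f x, f x) ≤ uniformity Y := nhds_le_uniformity (f x)
  exact h2.mono_right h3

/-- The logarithm of the normal density, with the covariance matrix rescaled by `c`. -/
theorem log_normalDensity {d : ℕ} (x μ : EuclideanSpace ℝ (Fin d)) {A : Matrix (Fin d) (Fin d) ℝ}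
    {c : ℝ} (hc : 0 < c) (hA : 0 < (c • A).det) :
    0 < normalDensity x μ A ∧ Real.log (normalDensity x μ A) =
      -(1 / 2) * Real.log ((2 * Real.pi) ^ d / c ^ d) - 1 / 2 * Real.log (c • A).det -
        c / 2 * ((x - μ).ofLp ⬝ᵥ (c • A)⁻¹ *ᵥ (x - μ).ofLp) := by
  have hdet : (c • A).det = c ^ d * A.det := by simp
  have hA0 : 0 < A.det := by
    rw [hdet] at hA
    exact (pos_iff_pos_of_mul_pos hA).1 (by positivity)
  have hinv : A⁻¹ = c • (c • A)⁻¹ := by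
    have : Invertible c := invertibleOfNonzero hc.ne'
    rw [Matrix.inv_smul A c hA0.ne'.isUnit, invOf_eq_inv, smul_inv_smul₀ hc.ne']
  have hpos : 0 < (2 * Real.pi) ^ d * A.det := by positivity
  refine ⟨by unfold normalDensity; positivity, ?_⟩
  rw [normalDensity, Real.log_mul (by positivity) (Real.exp_ne_zero _), Real.log_exp, Real.log_inv,
    Real.log_sqrt hpos.le, hinv, Matrix.smul_mulVec, dotProduct_smul, smul_eq_mul]
  have h1 : Real.log ((2 * Real.pi) ^ d * A.det) =
      Real.log ((2 * Real.pi) ^ d / c ^ d) + Real.log (c • A).det := by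
    rw [← Real.log_mul (by positivity) hA.ne', hdet]
    congr 1
    field_simp
  rw [h1]
  ring

namespace Experiment

variable {p d : ℕ} {E : Experiment p d} {b : EuclideanSpace ℝ (Fin p) → EuclideanSpace ℝ (Fin d)}
    {b₀ : EuclideanSpace ℝ (Fin d)} {Sig : EuclideanSpace ℝ (Fin p) → Matrix (Fin d) (Fin d) ℝ}
    {θs : EuclideanSpace ℝ (Fin p)}

theorem tendsto_scaled_cov {ν : ℕ → ℕ} (hν : Tendsto ν atTop atTop)
    (hSig_cont : ContinuousOn Sig E.Θ)
    (hSig : ∀ i j, TendstoUniformlyOn (fun (n : ℕ) θ => (n : ℝ) * E.covMat n θ i j)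
      (fun θ => Sig θ i j) atTop E.Θ) {x : EuclideanSpace ℝ (Fin p)} (hx : x ∈ E.Θ) :
    Tendsto (fun q : ℕ × EuclideanSpace ℝ (Fin p) => (ν q.1 : ℝ) • E.covMat (ν q.1) q.2)
      (atTop ×ˢ 𝓝[E.Θ] x) (𝓝 (Sig x)) := by
  refine tendsto_pi_nhds.2 fun i => tendsto_pi_nhds.2 fun j => ?_
  have h1 : TendstoUniformlyOn (fun k θ => (ν k : ℝ) * E.covMat (ν k) θ i j)
      (fun θ => Sig θ i j) atTop E.Θ := fun u hu => hν.eventually (hSig i j u hu)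
  exact tendsto_uncurry_of_tendstoUniformlyOn h1
    ((continuous_apply_apply i j).comp_continuousOn hSig_cont) hx

/-- The limit determinant attains a positive minimum on the compact `Θ`, and uniform convergence
eventually stays within that distance. -/
theorem eventually_det_pos (hΘ : IsCompact E.Θ)
    (hSig_cont : ContinuousOn Sig E.Θ)
    (hSig_pos : ∀ θ ∈ E.Θ, (Sig θ).PosDef)
    (hSig : ∀ i j, TendstoUniformlyOn (fun (n : ℕ) θ => (n : ℝ) * E.covMat n θ i j)
      (fun θ => Sig θ i j) atTop E.Θ) :
    ∀ᶠ n : ℕ in atTop, ∀ θ ∈ E.Θ, 0 < ((n : ℝ) • E.covMat n θ).det := by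
  have hcont : ContinuousOn (fun θ => (Sig θ).det) E.Θ :=
    Continuous.comp_continuousOn (Continuous.matrix_det continuous_id) hSig_cont
  have h := tendstoUniformlyOn_of_tendsto_uncurry
    (F := fun (n : ℕ) θ => ((n : ℝ) • E.covMat n θ).det) hΘ hcont (fun x hx =>
    ((Continuous.matrix_det continuous_id).tendsto _).comp
      (tendsto_scaled_cov tendsto_id hSig_cont hSig hx))
  rcases E.Θ.eq_empty_or_nonempty with he | hne
  · simp [he]
  obtain ⟨θ₀, hθ₀, hmin⟩ := hΘ.exists_isMinOn hne hcont
  filter_upwards [Metric.tendstoUniformlyOn_iff.1 h _ (hSig_pos θ₀ hθ₀).det_pos] with n hn θ hθ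
  have h1 := hn θ hθ
  have h2 : (Sig θ₀).det ≤ (Sig θ).det := hmin hθ
  rw [Real.dist_eq] at h1
  have := (abs_lt.1 h1).2
  linarith

theorem tendsto_quad_inv {ι : Type*} {l : Filter ι}
    {A : ι → Matrix (Fin d) (Fin d) ℝ} {A₀ : Matrix (Fin d) (Fin d) ℝ}
    {v : ι → EuclideanSpace ℝ (Fin d)} {v₀ : EuclideanSpace ℝ (Fin d)}
    (hA : Tendsto A l (𝓝 A₀)) (hA₀ : A₀.det ≠ 0) (hv : Tendsto v l (𝓝 v₀)) :
    Tendsto (fun q => (v q).ofLp ⬝ᵥ (A q)⁻¹ *ᵥ (v q).ofLp) l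
      (𝓝 (v₀.ofLp ⬝ᵥ A₀⁻¹ *ᵥ v₀.ofLp)) := by
  have hinv : Tendsto (fun q => (A q)⁻¹) l (𝓝 A₀⁻¹) := by
    simp only [Matrix.inv_def, Ring.inverse_eq_inv']
    have h1 : Tendsto (fun q => (A q).det) l (𝓝 A₀.det) :=
      ((Continuous.matrix_det continuous_id).tendsto _).comp hA
    have h2 : Tendsto (fun q => (A q).adjugate) l (𝓝 A₀.adjugate) :=
      ((Continuous.matrix_adjugate continuous_id).tendsto _).comp hA
    exact (h1.inv₀ hA₀).smul h2
  have hc : Continuous fun w : Matrix (Fin d) (Fin d) ℝ × EuclideanSpace ℝ (Fin d) =>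
      w.2.ofLp ⬝ᵥ w.1 *ᵥ w.2.ofLp := by
    refine Continuous.dotProduct (by fun_prop) (Continuous.matrix_mulVec continuous_fst (by fun_prop))
  exact (hc.tendsto (A₀⁻¹, v₀)).comp (hinv.prodMk_nhds hv)

theorem continuousOn_limitCriterion (hb_cont : ContinuousOn b E.Θ) (hSig_cont : ContinuousOn Sig E.Θ)
    (hSig_pos : ∀ θ ∈ E.Θ, (Sig θ).PosDef) : ContinuousOn (limitCriterion b Sig b₀) E.Θ := by
  intro x hx
  have h := tendsto_quad_inv (v := fun θ => b θ - b₀) (hSig_cont x hx).tendsto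
    (hSig_pos x hx).det_pos.ne' ((hb_cont x hx).tendsto.sub_const b₀)
  exact h.const_mul (-(1 / 2))

/-- Uniform convergence of the normalized log likelihood ratio. -/
theorem tendstoUniformlyOn_logRatio {ν : ℕ → ℕ} (hν : Tendsto ν atTop atTop)
    {s : ℕ → EuclideanSpace ℝ (Fin d)} (hs : Tendsto s atTop (𝓝 b₀)) (hΘ : IsCompact E.Θ)
    (hθs : θs ∈ E.Θ)
    (hb : TendstoUniformlyOn (fun n θ => E.mean n θ) b atTop E.Θ)
    (hb_cont : ContinuousOn b E.Θ)
    (hSig_cont : ContinuousOn Sig E.Θ)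
    (hSig_pos : ∀ θ ∈ E.Θ, (Sig θ).PosDef)
    (hSig : ∀ i j, TendstoUniformlyOn (fun (n : ℕ) θ => (n : ℝ) * E.covMat n θ i j)
      (fun θ => Sig θ i j) atTop E.Θ) :
    TendstoUniformlyOn (fun k θ => (ν k : ℝ)⁻¹ *
        (Real.log (E.exactSL (ν k) (s k) θ) - Real.log (E.exactSL (ν k) (s k) θs)))
      (fun θ => limitCriterion b Sig b₀ θ - limitCriterion b Sig b₀ θs) atTop E.Θ := by
  have hQ := continuousOn_limitCriterion (b₀ := b₀) hb_cont hSig_cont hSig_pos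
  have hνr : Tendsto (fun k => (ν k : ℝ)⁻¹) atTop (𝓝 0) :=
    tendsto_inv_atTop_zero.comp (tendsto_natCast_atTop_atTop.comp hν)
  -- The normalized log density without its constant free of `θ`, which cancels in the ratio. The
  -- log determinant carries a factor `1/n` and disappears, leaving the quadratic form.
  set ψ : ℕ → EuclideanSpace ℝ (Fin p) → ℝ := fun k θ =>
    -(1 / 2) * ((ν k : ℝ)⁻¹ * Real.log ((ν k : ℝ) • E.covMat (ν k) θ).det) -
      1 / 2 * ((s k - E.mean (ν k) θ).ofLp ⬝ᵥ ((ν k : ℝ) • E.covMat (ν k) θ)⁻¹ *ᵥ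
        (s k - E.mean (ν k) θ).ofLp) with hψ
  have hψlim : TendstoUniformlyOn ψ (limitCriterion b Sig b₀) atTop E.Θ := by
    refine tendstoUniformlyOn_of_tendsto_uncurry hΘ hQ fun x hx => ?_
    have hA := tendsto_scaled_cov hν hSig_cont hSig hx
    have hbν : TendstoUniformlyOn (fun k θ => E.mean (ν k) θ) b atTop E.Θ :=
      fun u hu => hν.eventually (hb u hu)
    have hm := tendsto_uncurry_of_tendstoUniformlyOn hbν hb_cont hx
    have hv : Tendsto (fun q : ℕ × EuclideanSpace ℝ (Fin p) => s q.1 - E.mean (ν q.1) q.2)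
        (atTop ×ˢ 𝓝[E.Θ] x) (𝓝 (b₀ - b x)) := (hs.comp tendsto_fst).sub hm
    have hdet0 := (hSig_pos x hx).det_pos.ne'
    have h1 := tendsto_quad_inv hA hdet0 hv
    have hdet : Tendsto (fun q : ℕ × EuclideanSpace ℝ (Fin p) =>
        ((ν q.1 : ℝ) • E.covMat (ν q.1) q.2).det) (atTop ×ˢ 𝓝[E.Θ] x) (𝓝 (Sig x).det) :=
      ((Continuous.matrix_det continuous_id).tendsto _).comp hA
    have h2 := (hνr.comp (tendsto_fst (f := atTop) (g := 𝓝[E.Θ] x))).mul (hdet.log hdet0)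
    have h3 := (h2.const_mul (-(1 / 2))).sub (h1.const_mul (1 / 2))
    convert h3 using 2
    · rfl
    rw [limitCriterion, ← neg_sub (b x) b₀]
    simp only [WithLp.ofLp_neg, Matrix.mulVec_neg, dotProduct_neg, neg_dotProduct]
    ring
  have hsub : TendstoUniformlyOn (fun k θ => ψ k θ - ψ k θs)
      (fun θ => limitCriterion b Sig b₀ θ - limitCriterion b Sig b₀ θs) atTop E.Θ := by
    refine hψlim.sub ?_
    exact (hψlim.tendsto_at hθs).tendstoUniformlyOn_const _
  refine hsub.congr ?_
  have hd := eventually_det_pos hΘ hSig_cont hSig_pos hSig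
  filter_upwards [hν.eventually hd, hν.eventually_gt_atTop 0] with k hk hk0 θ hθ
  have hpos : (0 : ℝ) < ν k := by exact_mod_cast hk0
  simp only [exactSL, hψ]
  rw [(log_normalDensity _ _ hpos (hk θ hθ)).2, (log_normalDensity _ _ hpos (hk θs hθs)).2]
  field_simp
  ring

/-- By compactness, uniqueness of the maximizer leaves a gap `2η` outside the ball; uniform
convergence costs at most `η` of it. -/
theorem exists_separation {ν : ℕ → ℕ} (hν : Tendsto ν atTop atTop)
    {s : ℕ → EuclideanSpace ℝ (Fin d)} (hs : Tendsto s atTop (𝓝 b₀)) (hΘ : IsCompact E.Θ)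
    (hθs : θs ∈ E.Θ)
    (hb : TendstoUniformlyOn (fun n θ => E.mean n θ) b atTop E.Θ)
    (hb_cont : ContinuousOn b E.Θ)
    (hSig_cont : ContinuousOn Sig E.Θ)
    (hSig_pos : ∀ θ ∈ E.Θ, (Sig θ).PosDef)
    (hSig : ∀ i j, TendstoUniformlyOn (fun (n : ℕ) θ => (n : ℝ) * E.covMat n θ i j)
      (fun θ => Sig θ i j) atTop E.Θ)
    (hmax : ∀ θ ∈ E.Θ, IsMaxOn (limitCriterion b Sig b₀) E.Θ θ → θ = θs)
    {ε : ℝ} (hε : 0 < ε) :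
    ∃ η, 0 < η ∧ ∀ᶠ k in atTop, ∀ θ ∈ E.Θ, ε ≤ dist θ θs →
      Real.log (E.exactSL (ν k) (s k) θ) - Real.log (E.exactSL (ν k) (s k) θs) ≤
        -η * √(ν k : ℝ) ^ 2 := by
  have hQ := continuousOn_limitCriterion (b₀ := b₀) hb_cont hSig_cont hSig_pos
  have hunif := tendstoUniformlyOn_logRatio hν hs hΘ hθs hb hb_cont hSig_cont hSig_pos hSig
  set Q := limitCriterion b Sig b₀
  have hfar : ∃ η, 0 < η ∧ ∀ θ ∈ E.Θ, ε ≤ dist θ θs → Q θ - Q θs ≤ -(2 * η) := by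
    set F := E.Θ ∩ {θ | ε ≤ dist θ θs}
    have hF : IsCompact F := hΘ.inter_right (isClosed_le continuous_const (by fun_prop))
    rcases F.eq_empty_or_nonempty with he | hne
    · exact ⟨1, one_pos, fun θ hθ hd => absurd (show θ ∈ F from ⟨hθ, hd⟩) (by simp [he])⟩
    obtain ⟨θ₁, hθ₁, hm⟩ := hF.exists_isMaxOn hne (hQ.mono inter_subset_left)
    obtain ⟨θ₂, hθ₂, hm₂⟩ := hΘ.exists_isMaxOn ⟨θs, hθs⟩ hQ
    -- `hmax` only excludes other maximizers; that `θs` is one follows because compactness provides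
    -- some maximizer.
    obtain rfl := hmax θ₂ hθ₂ hm₂
    have hlt : Q θ₁ < Q θ₂ := by
      by_contra hle
      have h1 : IsMaxOn Q E.Θ θ₁ := fun θ hθ => (hm₂ hθ).trans (not_lt.1 hle)
      have h2 := hmax θ₁ hθ₁.1 h1
      have h3 : ε ≤ dist θ₁ θ₂ := hθ₁.2
      rw [h2, dist_self] at h3
      linarith
    refine ⟨(Q θ₂ - Q θ₁) / 2, by linarith, fun θ hθ hd => ?_⟩
    have : Q θ ≤ Q θ₁ := hm ⟨hθ, hd⟩
    linarith
  obtain ⟨η, hη, hη'⟩ := hfar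
  refine ⟨η, hη, ?_⟩
  filter_upwards [Metric.tendstoUniformlyOn_iff.1 hunif η hη, hν.eventually_gt_atTop 0] with
    k hk hk0 θ hθ hd
  have hpos : (0 : ℝ) < ν k := by exact_mod_cast hk0
  have h1 := hk θ hθ
  rw [Real.dist_eq] at h1
  have h2 := (abs_lt.1 h1).1
  have h3 := hη' θ hθ hd
  have h4 : (ν k : ℝ)⁻¹ * (Real.log (E.exactSL (ν k) (s k) θ) -
      Real.log (E.exactSL (ν k) (s k) θs)) ≤ -η := by linarith
  rw [inv_mul_eq_div, div_le_iff₀ hpos] at h4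
  rwa [Real.sq_sqrt hpos.le]

end Experiment
end BSL

/-! ### Second order Taylor expansion. -/

namespace BSL

/-- The mean value inequality is applied first to `φ'` and then to `φ`, each time after subtracting
the Taylor polynomial. The constant is not sharp, which is harmless here. -/
theorem abs_taylor_two_le {φ φ' φ'' : ℝ → ℝ} {C : ℝ} (hC : 0 ≤ C)
    (h1 : ∀ t ∈ Icc (0 : ℝ) 1, HasDerivAt φ (φ' t) t)
    (h2 : ∀ t ∈ Icc (0 : ℝ) 1, HasDerivAt φ' (φ'' t) t)
    (hb : ∀ t ∈ Icc (0 : ℝ) 1, |φ'' t - φ'' 0| ≤ C) :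
    |φ 1 - φ 0 - φ' 0 - 1 / 2 * φ'' 0| ≤ C := by
  have hd1 : ∀ t ∈ Icc (0 : ℝ) 1, |φ' t - φ' 0 - t * φ'' 0| ≤ C := by
    intro t ht
    have hd : ∀ x ∈ Icc (0 : ℝ) t, HasDerivWithinAt (fun x => φ' x - x * φ'' 0)
        (φ'' x - φ'' 0) (Icc 0 t) x := fun x hx => by
      have := (h2 x ⟨hx.1, hx.2.trans ht.2⟩).sub ((hasDerivAt_id x).mul_const (φ'' 0))
      exact (this.congr_deriv (by simp)).hasDerivWithinAt
    have h3 := norm_image_sub_le_of_norm_deriv_le_segment' hd (C := C)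
      (fun x hx => hb x ⟨hx.1, hx.2.le.trans ht.2⟩) t (right_mem_Icc.2 ht.1)
    rw [Real.norm_eq_abs] at h3
    have h4 : C * (t - 0) ≤ C := by nlinarith [ht.1, ht.2]
    refine le_trans (le_of_eq ?_) (h3.trans h4)
    congr 1
    ring
  have hd : ∀ x ∈ Icc (0 : ℝ) 1, HasDerivWithinAt
      (fun x => φ x - x * φ' 0 - 1 / 2 * x ^ 2 * φ'' 0)
      (φ' x - φ' 0 - x * φ'' 0) (Icc 0 1) x := fun x hx => by
    have := ((h1 x hx).sub ((hasDerivAt_id x).mul_const (φ' 0))).sub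
      ((((hasDerivAt_pow 2 x).const_mul (1 / 2)).mul_const (φ'' 0)))
    exact (this.congr_deriv (by simp)).hasDerivWithinAt
  have h3 := norm_image_sub_le_of_norm_deriv_le_segment_01' hd (C := C)
    (fun x hx => hd1 x ⟨hx.1, hx.2.le⟩)
  rw [Real.norm_eq_abs] at h3
  refine le_trans (le_of_eq ?_) h3
  congr 1
  ring

theorem bilin_eq_sum {p : ℕ} (B : EuclideanSpace ℝ (Fin p) →L[ℝ] EuclideanSpace ℝ (Fin p) →L[ℝ] ℝ)
    (h : EuclideanSpace ℝ (Fin p)) :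
    B h h = quad (Matrix.of fun i j => B (EuclideanSpace.single i 1) (EuclideanSpace.single j 1)) h := by
  have hh : h = ∑ i, h i • EuclideanSpace.single i (1 : ℝ) := by
    simpa using ((EuclideanSpace.basisFun (Fin p) ℝ).sum_repr h).symm
  conv_lhs => rw [hh]
  simp only [map_sum, map_smul, _root_.sum_apply, _root_.smul_apply,
    smul_eq_mul, quad, dotProduct, Matrix.mulVec, Matrix.of_apply, Finset.mul_sum]
  rw [Finset.sum_comm]
  refine Finset.sum_congr rfl fun i _ => Finset.sum_congr rfl fun j _ => ?_
  ring

theorem quad_sub_matrix {p : ℕ} (A B : Matrix (Fin p) (Fin p) ℝ) (h : EuclideanSpace ℝ (Fin p)) :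
    quad A h - quad B h = quad (A - B) h := by
  simp [quad, Matrix.sub_mulVec, dotProduct_sub]

theorem quad_smul_matrix {p : ℕ} (c : ℝ) (A : Matrix (Fin p) (Fin p) ℝ)
    (h : EuclideanSpace ℝ (Fin p)) : quad (c • A) h = c * quad A h := by
  simp [quad, Matrix.smul_mulVec]

theorem abs_quad_le {p : ℕ} {A : Matrix (Fin p) (Fin p) ℝ} {c : ℝ} (hA : ∀ i j, |A i j| ≤ c)
    (h : EuclideanSpace ℝ (Fin p)) : |quad A h| ≤ p ^ 2 * c * ‖h‖ ^ 2 := by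
  have h0 : ∀ i j, |h i * (A i j * h j)| ≤ c * ‖h‖ ^ 2 := fun i j => by
    have hc : 0 ≤ c := (abs_nonneg _).trans (hA i j)
    rw [abs_mul, abs_mul]
    calc _ ≤ ‖h‖ * (c * ‖h‖) := by
          gcongr
          · exact abs_coord_le h i
          · exact hA i j
          · exact abs_coord_le h j
      _ = _ := by ring
  simp only [quad, dotProduct, Matrix.mulVec, Finset.mul_sum]
  calc _ ≤ ∑ i, |∑ j, h i * (A i j * h j)| := Finset.abs_sum_le_sum_abs _ _
    _ ≤ ∑ i : Fin p, ∑ j : Fin p, c * ‖h‖ ^ 2 := by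
        gcongr with i _
        exact (Finset.abs_sum_le_sum_abs _ _).trans (Finset.sum_le_sum fun j _ => h0 i j)
    _ = _ := by
        simp only [Finset.sum_const, Finset.card_univ, Fintype.card_fin, nsmul_eq_mul]
        ring

/-- Second order Taylor expansion with a Lipschitz Hessian. -/
theorem abs_taylor_hessian_le {p : ℕ} {f : EuclideanSpace ℝ (Fin p) → ℝ}
    {θs : EuclideanSpace ℝ (Fin p)} {ρ c : ℝ} (hc : 0 ≤ c)
    (hf : ∀ θ ∈ Metric.closedBall θs ρ, ContDiffAt ℝ 2 f θ)
    (hH : ∀ θ ∈ Metric.closedBall θs ρ, ∀ i j,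
      |iteratedFDeriv ℝ 2 f θ ![EuclideanSpace.single i 1, EuclideanSpace.single j 1] -
        iteratedFDeriv ℝ 2 f θs ![EuclideanSpace.single i 1, EuclideanSpace.single j 1]| ≤ c)
    {h : EuclideanSpace ℝ (Fin p)} (hh : ‖h‖ ≤ ρ) :
    |f (θs + h) - f θs - inner ℝ (gradient f θs) h - 1 / 2 * quad (Matrix.of fun i j =>
      iteratedFDeriv ℝ 2 f θs ![EuclideanSpace.single i 1, EuclideanSpace.single j 1]) h| ≤
      p ^ 2 * c * ‖h‖ ^ 2 := by
  have hmem : ∀ t ∈ Icc (0 : ℝ) 1, θs + t • h ∈ Metric.closedBall θs ρ := fun t ht => by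
    simp only [Metric.mem_closedBall, dist_eq_norm, add_sub_cancel_left, norm_smul,
      Real.norm_of_nonneg ht.1]
    nlinarith [ht.1, ht.2, norm_nonneg h]
  have hquad : ∀ θ, fderiv ℝ (fderiv ℝ f) θ h h = quad (Matrix.of fun i j =>
      iteratedFDeriv ℝ 2 f θ ![EuclideanSpace.single i 1, EuclideanSpace.single j 1]) h := fun θ => by
    rw [bilin_eq_sum]
    simp only [iteratedFDeriv_two_apply]
    rfl
  have hline : ∀ t : ℝ, HasDerivAt (fun t : ℝ => θs + t • h) h t := fun t => by
    simpa using ((hasDerivAt_id t).smul_const h).const_add θs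
  have key := abs_taylor_two_le (φ := fun t => f (θs + t • h))
    (φ' := fun t => fderiv ℝ f (θs + t • h) h)
    (φ'' := fun t => fderiv ℝ (fderiv ℝ f) (θs + t • h) h h)
    (C := p ^ 2 * c * ‖h‖ ^ 2) (by positivity)
    (fun t ht => by
      have h1 := ((hf _ (hmem t ht)).differentiableAt (by norm_num)).hasFDerivAt
      exact h1.comp_hasDerivAt t (hline t))
    (fun t ht => by
      have h1 := (((hf _ (hmem t ht)).fderiv_right (m := 1) (by norm_num)).differentiableAt
        (by norm_num)).hasFDerivAt
      have h2 := h1.comp_hasDerivAt t (hline t)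
      exact ((ContinuousLinearMap.apply ℝ ℝ h).hasFDerivAt.comp_hasDerivAt t h2))
    (fun t ht => by
      simp only [hquad, zero_smul, add_zero, quad_sub_matrix]
      refine abs_quad_le (fun i j => ?_) h
      exact hH _ (hmem t ht) i j)
  simp only [one_smul, zero_smul, add_zero, hquad] at key
  have hg : inner ℝ (gradient f θs) h = fderiv ℝ f θs h := by
    simp [gradient]
  rw [hg]
  exact key

end BSL

/-! ### Good outcomes satisfy the Laplace setting. -/

namespace BSL

/-- The deterministic regularity conditions on the model, the prior and the limit quantities. -/
structure Regular {p d : ℕ} (E : Experiment p d)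
    (b : EuclideanSpace ℝ (Fin p) → EuclideanSpace ℝ (Fin d)) (b₀ : EuclideanSpace ℝ (Fin d))
    (Sig : EuclideanSpace ℝ (Fin p) → Matrix (Fin d) (Fin d) ℝ)
    (J : Matrix (Fin p) (Fin p) ℝ) (θs : EuclideanSpace ℝ (Fin p)) : Prop where
  compact : IsCompact E.Θ
  smooth : ∀ᶠ n in atTop, ∀ s : EuclideanSpace ℝ (Fin d),
    ContDiffOn ℝ 2 (fun θ => Real.log (E.exactSL n s θ)) (interior E.Θ)
  mean : TendstoUniformlyOn (fun n θ => E.mean n θ) b atTop E.Θ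
  continuousOn_mean : ContinuousOn b E.Θ
  cov : ∀ i j, TendstoUniformlyOn (fun (n : ℕ) θ => (n : ℝ) * E.covMat n θ i j)
    (fun θ => Sig θ i j) atTop E.Θ
  continuousOn_cov : ContinuousOn Sig E.Θ
  posDef_cov : ∀ θ ∈ E.Θ, (Sig θ).PosDef
  mem_interior : θs ∈ interior E.Θ
  posDef : J.PosDef
  unique_max : ∀ θ ∈ E.Θ, IsMaxOn (limitCriterion b Sig b₀) E.Θ θ → θ = θs
  prior_pos : 0 < E.prior θs
  continuousAt_prior : ContinuousAt E.prior θs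

/-- The outcomes `y` at which the random quantities of the experiment are within `ε` of their
limits, the Hessian is `K`-Lipschitz within `δ` of `θs`, and the normalized score is bounded
by `T`. -/
structure GoodAt {p d : ℕ} (E : Experiment p d) (m : ℕ → ℕ) (b₀ : EuclideanSpace ℝ (Fin d))
    (J : Matrix (Fin p) (Fin p) ℝ) (θs : EuclideanSpace ℝ (Fin p)) (δ K T ε : ℝ) (n : ℕ)
    (y : Fin n → ℝ) : Prop where
  large : ε⁻¹ ≤ n
  summary : dist (E.S n y) b₀ < ε
  hess : ∀ i j, |E.hess n θs y i j + J i j| < ε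
  lipschitz : ∀ θ ∈ interior E.Θ, dist θ θs ≤ δ → ∀ i j,
    |E.hess n θ y i j - E.hess n θs y i j| ≤ K * dist θ θs
  estimate : ∀ θ ∈ E.Θ, |E.estSL n (m n) (E.S n y) θ - E.exactSL n (E.S n y) θ| ≤
    ε * E.exactSL n (E.S n y) θ
  score : ‖√(n : ℝ) • E.score n θs y‖ ≤ T

/-- A non-integrable function has integral `0` by convention, which contradicts total mass one. -/
theorem integrableOn_prior {p d : ℕ} (E : Experiment p d) : IntegrableOn E.prior E.Θ := by
  by_contra h
  have h1 := E.integral_prior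
  rw [integral_undef h] at h1
  exact zero_ne_one h1

namespace Regular

variable {p d : ℕ} {E : Experiment p d} {m : ℕ → ℕ}
    {b : EuclideanSpace ℝ (Fin p) → EuclideanSpace ℝ (Fin d)} {b₀ : EuclideanSpace ℝ (Fin d)}
    {Sig : EuclideanSpace ℝ (Fin p) → Matrix (Fin d) (Fin d) ℝ}
    {J : Matrix (Fin p) (Fin p) ℝ} {θs : EuclideanSpace ℝ (Fin p)}
    (R : Regular E b b₀ Sig J θs)

include R

theorem eventually_exactSL_pos : ∀ᶠ n : ℕ in atTop, ∀ s, ∀ θ ∈ E.Θ, 0 < E.exactSL n s θ := by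
  filter_upwards [Experiment.eventually_det_pos R.compact R.continuousOn_cov R.posDef_cov R.cov,
    eventually_gt_atTop 0] with n hn hn0 s θ hθ
  exact (log_normalDensity _ _ (by exact_mod_cast hn0) (hn θ hθ)).1

/-- Local quadratic expansion of the log likelihood ratio. -/
theorem exists_quadratic {δ K T : ℝ} (hδ : 0 < δ) {ε : ℝ} (hε : 0 < ε) :
    ∃ ρ ε₀ : ℝ, 0 < ρ ∧ 0 < ε₀ ∧ ∀ᶠ n : ℕ in atTop, ∀ y : Fin n → ℝ, ∀ ε' ≤ ε₀,
      GoodAt E m b₀ J θs δ K T ε' n y → ∀ h : EuclideanSpace ℝ (Fin p), ‖h‖ ≤ ρ →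
      |Real.log (E.exactSL n (E.S n y) (θs + h)) - Real.log (E.exactSL n (E.S n y) θs) -
        √(n : ℝ) * inner ℝ (√(n : ℝ) • E.score n θs y) h + 1 / 2 * √(n : ℝ) ^ 2 * quad J h| ≤
        ε * √(n : ℝ) ^ 2 * ‖h‖ ^ 2 := by
  obtain ⟨ρ₁, hρ₁, hball⟩ := Metric.mem_nhds_iff.1 (isOpen_interior.mem_nhds R.mem_interior)
  set P : ℝ := (p : ℝ) ^ 2 with hP
  have hP0 : 0 ≤ P := by positivity
  -- The last entry makes the Taylor error from the varying Hessian at most `ε / 2`. The tolerance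
  -- `ε / (P + 1)` below, with `P = p²` from the entrywise bound, handles the other half, replacing
  -- the Hessian at `θs` by `-J`.
  set ρ := min (min δ (ρ₁ / 2)) (ε / (2 * (P * |K| + 1))) with hρ
  have hρ0 : 0 < ρ := by positivity
  refine ⟨ρ, ε / (P + 1), hρ0, by positivity, ?_⟩
  filter_upwards [R.smooth, eventually_gt_atTop 0] with n hsm hn y ε' hε' hgood h hh
  have hpos : (0 : ℝ) < n := by exact_mod_cast hn
  set f : EuclideanSpace ℝ (Fin p) → ℝ := fun θ => Real.log (E.exactSL n (E.S n y) θ) with hf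
  have hint : ∀ θ ∈ Metric.closedBall θs ρ, θ ∈ interior E.Θ := fun θ hθ => hball (by
    have h1 : dist θ θs ≤ ρ := hθ
    have h2 : ρ ≤ ρ₁ / 2 := (min_le_left _ _).trans (min_le_right _ _)
    rw [Metric.mem_ball]; linarith)
  have hhess : ∀ θ i j, iteratedFDeriv ℝ 2 f θ
      ![EuclideanSpace.single i 1, EuclideanSpace.single j 1] = n * E.hess n θ y i j := by
    intro θ i j
    simp only [Experiment.hess, Matrix.of_apply, ← hf]
    field_simp
  have hKρ : P * (|K| * ρ) ≤ ε / 2 := by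
    have h1 : ρ ≤ ε / (2 * (P * |K| + 1)) := min_le_right _ _
    rw [le_div_iff₀ (by positivity)] at h1
    nlinarith [abs_nonneg K]
  have key := abs_taylor_hessian_le (f := f) (θs := θs) (ρ := ρ) (c := n * (|K| * ρ))
    (by positivity)
    (fun θ hθ => (hsm (E.S n y)).contDiffAt (isOpen_interior.mem_nhds (hint θ hθ)))
    (fun θ hθ i j => by
      rw [hhess, hhess, ← mul_sub, abs_mul, abs_of_pos hpos]
      have h1 : dist θ θs ≤ ρ := hθ
      have h2 : ρ ≤ δ := (min_le_left _ _).trans (min_le_left _ _)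
      gcongr
      refine (hgood.lipschitz θ (hint θ hθ) (h1.trans h2) i j).trans ?_
      gcongr
      exact le_abs_self K) hh
  have hq1 : quad (Matrix.of fun i j => iteratedFDeriv ℝ 2 f θs
      ![EuclideanSpace.single i 1, EuclideanSpace.single j 1]) h = n * quad (E.hess n θs y) h := by
    rw [← quad_smul_matrix]
    congr 1
    ext i j
    simp [hhess]
  have hq2 : |quad (E.hess n θs y) h + quad J h| ≤ ε * ‖h‖ ^ 2 := by
    have h1 : quad (E.hess n θs y) h + quad J h = quad (E.hess n θs y + J) h := by
      simp [quad, Matrix.add_mulVec, dotProduct_add]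
    rw [h1]
    refine (abs_quad_le (c := ε / (P + 1)) (fun i j => ((hgood.hess i j).le.trans hε')) h).trans ?_
    gcongr
    rw [mul_div_assoc', div_le_iff₀ (by positivity)]
    nlinarith
  have hinner : √(n : ℝ) * inner ℝ (√(n : ℝ) • E.score n θs y) h = inner ℝ (gradient f θs) h := by
    rw [real_inner_smul_left, ← mul_assoc, Real.mul_self_sqrt hpos.le, Experiment.score,
      real_inner_smul_left, ← mul_assoc, mul_inv_cancel₀ hpos.ne', one_mul]
  rw [hinner, Real.sq_sqrt hpos.le]
  rw [hq1] at key
  have h3 : f (θs + h) - f θs - inner ℝ (gradient f θs) h + 1 / 2 * n * quad J h =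
      (f (θs + h) - f θs - inner ℝ (gradient f θs) h - 1 / 2 * (n * quad (E.hess n θs y) h)) +
        n / 2 * (quad (E.hess n θs y) h + quad J h) := by ring
  show |f (θs + h) - f θs - inner ℝ (gradient f θs) h + 1 / 2 * n * quad J h| ≤ _
  rw [h3]
  refine (abs_add_le _ _).trans ?_
  have h4 : |(n : ℝ) / 2 * (quad (E.hess n θs y) h + quad J h)| ≤ n / 2 * (ε * ‖h‖ ^ 2) := by
    rw [abs_mul, abs_of_pos (by positivity : (0 : ℝ) < n / 2)]
    gcongr
  have h5 : P * (n * (|K| * ρ)) * ‖h‖ ^ 2 ≤ n * (ε / 2) * ‖h‖ ^ 2 := by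
    have : P * (n * (|K| * ρ)) = n * (P * (|K| * ρ)) := by ring
    rw [this]
    gcongr
  linarith

/-- The constants `K` and `T` stay fixed while the tolerance tends to zero, so bounded random
quantities become bounded sequences and limits in probability become limits. The field `large`
forces the sample sizes to infinity. -/
theorem laplaceSetting {δ K T : ℝ} (hδ : 0 < δ) {ν : ℕ → ℕ} {y : (k : ℕ) → Fin (ν k) → ℝ}
    (hgood : ∀ k : ℕ, GoodAt E m b₀ J θs δ K T (1 / ((k : ℝ) + 1)) (ν k) (y k)) :
    LaplaceSetting E.Θ E.prior θs J (fun k => √(ν k : ℝ)) (fun k => √(ν k : ℝ) • E.score (ν k) θs (y k))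
      (fun k θ => Real.log (E.exactSL (ν k) (E.S (ν k) (y k)) θ) -
        Real.log (E.exactSL (ν k) (E.S (ν k) (y k)) θs))
      (fun k θ => E.estSL (ν k) (m (ν k)) (E.S (ν k) (y k)) θ /
        E.exactSL (ν k) (E.S (ν k) (y k)) θs) ∧
    ∀ᶠ k in atTop, 0 < E.exactSL (ν k) (E.S (ν k) (y k)) θs := by
  have hθs := interior_subset R.mem_interior
  have hν : Tendsto ν atTop atTop := by
    refine tendsto_atTop_mono (fun k => ?_) tendsto_id
    have h1 := (hgood k).large
    simp only [one_div, inv_inv] at h1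
    have : (k : ℝ) ≤ ν k := by linarith
    exact_mod_cast this
  have h1k : Tendsto (fun k : ℕ => 1 / ((k : ℝ) + 1)) atTop (𝓝 0) := tendsto_one_div_add_atTop_nhds_zero_nat
  have hs : Tendsto (fun k => E.S (ν k) (y k)) atTop (𝓝 b₀) := by
    rw [tendsto_iff_dist_tendsto_zero]
    exact squeeze_zero (fun _ => dist_nonneg) (fun k => (hgood k).summary.le) h1k
  have hpos := hν.eventually R.eventually_exactSL_pos
  refine ⟨⟨R.compact, R.mem_interior, E.measurable_prior, R.prior_pos, integrableOn_prior E,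
    R.continuousAt_prior, R.posDef, ?_, ⟨T, fun k => (hgood k).score⟩, ?_, ?_, ?_, ?_⟩,
    hpos.mono fun k hk => hk _ θs hθs⟩
  · exact Real.tendsto_sqrt_atTop.comp (tendsto_natCast_atTop_atTop.comp hν)
  · intro k
    exact ((E.measurable_estSL _ _).comp measurable_prodMk_left).div_const _
  · intro ε hε
    filter_upwards [hpos, h1k.eventually_le_const hε] with k hk hle θ hθ
    have h1 := hk (E.S (ν k) (y k)) θ hθ
    have h2 := hk (E.S (ν k) (y k)) θs hθs
    rw [Real.exp_sub, Real.exp_log h1, Real.exp_log h2, ← sub_div, abs_div, abs_of_pos h2,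
      mul_div_assoc']
    gcongr
    exact ((hgood k).estimate θ hθ).trans (by gcongr)
  · intro ε hε
    exact Experiment.exists_separation hν hs R.compact hθs R.mean R.continuousOn_mean
      R.continuousOn_cov R.posDef_cov R.cov R.unique_max hε
  · intro ε hε
    obtain ⟨ρ, ε₀, hρ, hε₀, h⟩ := R.exists_quadratic (m := m) (K := K) (T := T) hδ hε
    refine ⟨ρ, hρ, ?_⟩
    filter_upwards [hν.eventually h, h1k.eventually_le_const hε₀] with k hk hle
    exact hk (y k) _ hle (hgood k)

end Regular
end BSL

/-! ### From good sequences to convergence in probability. -/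

namespace BSL

section Probability

variable {Ω : ℕ → Type*} [∀ n, MeasurableSpace (Ω n)] {μ : (n : ℕ) → Measure (Ω n)}

/-- A sequence that converges in distribution is bounded in probability. -/
theorem exists_bound_of_tendstoInDistribution [∀ n, IsProbabilityMeasure (μ n)] {F : Type*}
    [NormedAddCommGroup F] [SecondCountableTopology F] [CompleteSpace F]
    [MeasurableSpace F] [BorelSpace F] {X : (n : ℕ) → Ω n → F} {ξ : Measure F}
    [IsProbabilityMeasure ξ] (h : TendstoInDistribution X atTop id μ ξ) {η : ℝ} (hη : 0 < η) :
    ∃ T : ℝ, ∀ᶠ n in atTop, μ n {ω | ¬ ‖X n ω‖ ≤ T} ≤ ENNReal.ofReal η := by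
  obtain ⟨K, hK, hKξ⟩ := isTightMeasureSet_iff_exists_isCompact_measure_compl_le.1
    (isTightMeasureSet_singleton (μ := ξ)) (ENNReal.ofReal (η / 2)) (by simpa using hη)
  have hKξ' := hKξ ξ rfl
  obtain ⟨T, hT⟩ := hK.isBounded.subset_closedBall 0
  set C : Set F := {x | T + 1 ≤ ‖x‖}
  have hC : IsClosed C := isClosed_le continuous_const continuous_norm
  have hCK : C ⊆ Kᶜ := fun x hx hxK => by
    have h1 : ‖x‖ ≤ T := by simpa using hT hxK
    have h2 : T + 1 ≤ ‖x‖ := hx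
    linarith
  -- The limit law is tight, and the portmanteau bound on the closed tail set passes this to the
  -- sequence.
  have hlim := ProbabilityMeasure.limsup_measure_closed_le_of_tendsto h.tendsto hC
  have hlt : ξ C < ENNReal.ofReal η :=
    ((measure_mono hCK).trans hKξ').trans_lt
      ((ENNReal.ofReal_lt_ofReal_iff hη).2 (half_lt_self hη))
  simp only [ProbabilityMeasure.coe_mk, Measure.map_id] at hlim
  refine ⟨T + 1, ?_⟩
  filter_upwards [eventually_lt_of_limsup_lt (hlim.trans_lt hlt)] with n hn
  rw [Measure.map_apply_of_aemeasurable (h.forall_aemeasurable n) hC.measurableSet] at hn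
  refine (measure_mono fun ω hω => ?_).trans hn.le
  exact (not_le.1 hω).le

theorem measure_union_le_ofReal {n : ℕ} {A B : Set (Ω n)} {a b : ℝ} (ha : 0 ≤ a) (hb : 0 ≤ b)
    (hA : μ n A ≤ ENNReal.ofReal a) (hB : μ n B ≤ ENNReal.ofReal b) :
    μ n (A ∪ B) ≤ ENNReal.ofReal (a + b) := by
  rw [ENNReal.ofReal_add ha hb]
  exact (measure_union_le _ _).trans (add_le_add hA hB)

end Probability

section Transfer

variable {p d : ℕ} {E : Experiment p d} {m : ℕ → ℕ} {b₀ : EuclideanSpace ℝ (Fin d)}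
    {J : Matrix (Fin p) (Fin p) ℝ} {θs : EuclideanSpace ℝ (Fin p)}

/-- The good outcomes have probability arbitrarily close to one. -/
theorem exists_goodAt {ξ : Measure (EuclideanSpace ℝ (Fin p))} [IsProbabilityMeasure ξ]
    {δ : ℝ}
    (hS : TendstoInProb E.P₀ (fun n y => E.S n y) b₀)
    (hH : ∀ i j, TendstoInProb E.P₀ (fun n y => E.hess n θs y i j) (-J i j))
    (hLip : ∀ η : ℝ, 0 < η → ∃ K : ℝ, ∀ᶠ n in atTop,
      E.P₀ n {y | ¬ ∀ θ ∈ interior E.Θ, dist θ θs ≤ δ → ∀ i j,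
        |E.hess n θ y i j - E.hess n θs y i j| ≤ K * dist θ θs} ≤ ENNReal.ofReal η)
    (hest : ∀ ε : ℝ, 0 < ε → Tendsto (fun n => E.P₀ n {y | ¬ ∀ θ ∈ E.Θ,
      |E.estSL n (m n) (E.S n y) θ - E.exactSL n (E.S n y) θ|
        ≤ ε * E.exactSL n (E.S n y) θ}) atTop (𝓝 0))
    (hscore : TendstoInDistribution (fun (n : ℕ) y => √(n : ℝ) • E.score n θs y) atTop id E.P₀ ξ)
    {η : ℝ} (hη : 0 < η) :
    ∃ K T : ℝ, ∀ ε, 0 < ε → ∀ᶠ n in atTop,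
      E.P₀ n {y | ¬ GoodAt E m b₀ J θs δ K T ε n y} ≤ ENNReal.ofReal η := by
  -- There are five random conditions in `GoodAt`; `large` is deterministic. `K` and `T` depend on
  -- `η` only, not on `ε`.
  have h5 : 0 < η / 5 := by positivity
  obtain ⟨K, hK⟩ := hLip (η / 5) h5
  obtain ⟨T, hT⟩ := exists_bound_of_tendstoInDistribution hscore h5
  refine ⟨K, T, fun ε hε => ?_⟩
  have hpos : 0 < ENNReal.ofReal (η / 5) := by simpa using h5
  have hH' : Tendsto (fun n => E.P₀ n (⋃ i, ⋃ j, {y | ε ≤ dist (E.hess n θs y i j) (-J i j)}))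
      atTop (𝓝 0) := by
    have hsum : Tendsto (fun n => ∑ i, ∑ j, E.P₀ n {y | ε ≤ dist (E.hess n θs y i j) (-J i j)})
        atTop (𝓝 0) := by
      have := tendsto_finsetSum Finset.univ fun i (_ : i ∈ Finset.univ) =>
        tendsto_finsetSum Finset.univ fun j (_ : j ∈ Finset.univ) => hH i j ε hε
      simpa using this
    refine tendsto_of_tendsto_of_tendsto_of_le_of_le tendsto_const_nhds hsum (fun _ => bot_le)
      fun n => ?_
    refine (measure_iUnion_fintype_le _ _).trans (Finset.sum_le_sum fun i _ => ?_)
    exact measure_iUnion_fintype_le _ _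
  filter_upwards [hK, hT, (hS ε hε).eventually_le_const hpos, hH'.eventually_le_const hpos,
    (hest ε hε).eventually_le_const hpos, eventually_ge_atTop ⌈ε⁻¹⌉₊] with n h1 h2 h3 h4 h6 h7
  have h8 := measure_union_le_ofReal (by positivity) h5.le (measure_union_le_ofReal (by positivity)
    h5.le (measure_union_le_ofReal (by positivity) h5.le
    (measure_union_le_ofReal h5.le h5.le h1 h2) h3) h4) h6
  refine (measure_mono fun y hy => ?_).trans (h8.trans (le_of_eq (by congr 1; ring)))
  by_contra hcon
  simp only [mem_union, not_or] at hcon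
  obtain ⟨⟨⟨⟨c1, c2⟩, c3⟩, c4⟩, c5⟩ := hcon
  refine hy ⟨(Nat.le_ceil _).trans (by exact_mod_cast h7), not_le.1 c3, fun i j => ?_,
    not_not.1 c1, not_not.1 c5, not_not.1 c2⟩
  by_contra hij
  refine c4 (mem_iUnion.2 ⟨i, mem_iUnion.2 ⟨j, ?_⟩⟩)
  show ε ≤ dist _ _
  rw [Real.dist_eq, sub_neg_eq_add]
  exact not_lt.1 hij

/-- Convergence along all good sequences implies convergence in probability. -/
theorem tendstoInProb_of_goodAt {δ : ℝ}
    (hgood : ∀ η, 0 < η → ∃ K T : ℝ, ∀ ε, 0 < ε → ∀ᶠ n in atTop,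
      E.P₀ n {y | ¬ GoodAt E m b₀ J θs δ K T ε n y} ≤ ENNReal.ofReal η)
    {Y : Type*} [PseudoMetricSpace Y] (X : (n : ℕ) → (Fin n → ℝ) → Y) (c : Y)
    (h : ∀ (K T : ℝ) (ν : ℕ → ℕ) (y : (k : ℕ) → Fin (ν k) → ℝ),
      (∀ k : ℕ, GoodAt E m b₀ J θs δ K T (1 / ((k : ℝ) + 1)) (ν k) (y k)) →
      Tendsto (fun k => X (ν k) (y k)) atTop (𝓝 c)) :
    TendstoInProb E.P₀ X c := by
  intro ε hε
  rw [ENNReal.tendsto_nhds_zero]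
  intro e he
  obtain ⟨η, hη, hηe⟩ : ∃ η : ℝ, 0 < η ∧ ENNReal.ofReal η ≤ e := by
    rcases eq_or_ne e ⊤ with rfl | htop
    · exact ⟨1, one_pos, le_top⟩
    · exact ⟨e.toReal, ENNReal.toReal_pos he.ne' htop, ENNReal.ofReal_toReal_le⟩
  obtain ⟨K, T, hKT⟩ := hgood η hη
  -- Otherwise each tolerance `1/(k+1)` admits a good outcome at distance at least `ε` from the
  -- limit, and these outcomes form a sequence contradicting `h`. The choice of outcomes needs no
  -- measurability.
  obtain ⟨k, hk⟩ : ∃ k : ℕ, ∀ n (y : Fin n → ℝ),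
      GoodAt E m b₀ J θs δ K T (1 / ((k : ℝ) + 1)) n y → dist (X n y) c < ε := by
    by_contra! hcon
    choose ν y hg hd using hcon
    have h1 := Metric.tendsto_nhds.1 (h K T ν y hg) ε hε
    obtain ⟨k, hk⟩ := h1.exists
    exact absurd hk (not_lt.2 (hd k))
  filter_upwards [hKT (1 / ((k : ℝ) + 1)) (by positivity)] with n hn
  refine (measure_mono fun y hy => ?_).trans (hn.trans hηe)
  exact fun hg => absurd (hk n y hg) (not_lt.2 hy)

end Transfer

/-- The posterior is invariant under scaling the likelihood; dividing by its exact value at `θs`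
brings in likelihood ratios. -/
theorem Experiment.eventually_posterior_eq {p d : ℕ} {E : Experiment p d} {m : ℕ → ℕ}
    {θs : EuclideanSpace ℝ (Fin p)} {ν : ℕ → ℕ} {y : (k : ℕ) → Fin (ν k) → ℝ}
    (h : ∀ᶠ k in atTop, 0 < E.exactSL (ν k) (E.S (ν k) (y k)) θs) :
    ∀ᶠ k in atTop, ∀ θ, E.posterior (ν k) (m (ν k)) (y k) θ =
      E.prior θ * (E.estSL (ν k) (m (ν k)) (E.S (ν k) (y k)) θ /
        E.exactSL (ν k) (E.S (ν k) (y k)) θs) /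
      ∫ θ' in E.Θ, E.prior θ' * (E.estSL (ν k) (m (ν k)) (E.S (ν k) (y k)) θ' /
        E.exactSL (ν k) (E.S (ν k) (y k)) θs) := by
  filter_upwards [h] with k hk θ
  simp only [mul_div_assoc', Experiment.posterior]
  rw [integral_div, div_div_div_cancel_right₀ hk.ne']

namespace Regular

variable {p d : ℕ} {E : Experiment p d} {m : ℕ → ℕ}
    {b : EuclideanSpace ℝ (Fin p) → EuclideanSpace ℝ (Fin d)} {b₀ : EuclideanSpace ℝ (Fin d)}
    {Sig : EuclideanSpace ℝ (Fin p) → Matrix (Fin d) (Fin d) ℝ}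
    {J : Matrix (Fin p) (Fin p) ℝ} {θs : EuclideanSpace ℝ (Fin p)}
    (R : Regular E b b₀ Sig J θs) {δ : ℝ} (hδ : 0 < δ)
    (hgood : ∀ η, 0 < η → ∃ K T : ℝ, ∀ ε, 0 < ε → ∀ᶠ n in atTop,
      E.P₀ n {y | ¬ GoodAt E m b₀ J θs δ K T ε n y} ≤ ENNReal.ofReal η)

include R

include hδ

theorem tendsto_posteriorCov {K T : ℝ} {ν : ℕ → ℕ} {y : (k : ℕ) → Fin (ν k) → ℝ}
    (hg : ∀ k : ℕ, GoodAt E m b₀ J θs δ K T (1 / ((k : ℝ) + 1)) (ν k) (y k)) (i j : Fin p) :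
    Tendsto (fun k => √(ν k : ℝ) ^ 2 * E.posteriorCov (ν k) (m (ν k)) (y k) i j) atTop
      (𝓝 (J⁻¹ i j)) := by
  obtain ⟨S, hpos⟩ := R.laplaceSetting hδ hg
  exact S.tendsto_cov (Experiment.eventually_posterior_eq hpos) i j

include hgood

/-- The local coordinate of the posterior mean is exactly the remainder in its linear expansion in
the score. -/
theorem tendstoInProb_posteriorMean :
    TendstoInProb E.P₀ (fun (n : ℕ) y => √(n : ℝ) • (E.posteriorMean n (m n) y - θs) -
      Matrix.toEuclideanCLM (𝕜 := ℝ) J⁻¹ (√(n : ℝ) • E.score n θs y)) 0 := by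
  refine tendstoInProb_of_goodAt hgood _ _ fun K T ν y hg => ?_
  obtain ⟨S, hpos⟩ := R.laplaceSetting hδ hg
  exact S.tendsto_mean (Experiment.eventually_posterior_eq hpos)

theorem tendstoInProb_posteriorCov (i j : Fin p) :
    TendstoInProb E.P₀ (fun (n : ℕ) y => (n : ℝ) * E.posteriorCov n (m n) y i j) (J⁻¹ i j) := by
  refine tendstoInProb_of_goodAt hgood _ _ fun K T ν y hg => ?_
  have h := R.tendsto_posteriorCov hδ hg i j
  simpa only [Real.sq_sqrt (Nat.cast_nonneg _)] using h

theorem tendstoInProb_posteriorStd (a : EuclideanSpace ℝ (Fin p)) (z : ℝ) :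
    TendstoInProb E.P₀ (fun (n : ℕ) y => √(n : ℝ) *
      (z * √(a.ofLp ⬝ᵥ E.posteriorCov n (m n) y *ᵥ a.ofLp))) (z * √(a.ofLp ⬝ᵥ J⁻¹ *ᵥ a.ofLp)) := by
  refine tendstoInProb_of_goodAt hgood _ _ fun K T ν y hg => ?_
  have h := R.tendsto_posteriorCov hδ hg
  simp only [Real.sq_sqrt (Nat.cast_nonneg _)] at h
  have h1 : Tendsto (fun k => (ν k : ℝ) *
      (a.ofLp ⬝ᵥ E.posteriorCov (ν k) (m (ν k)) (y k) *ᵥ a.ofLp)) atTop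
      (𝓝 (a.ofLp ⬝ᵥ J⁻¹ *ᵥ a.ofLp)) := by
    simp only [dotProduct, Matrix.mulVec, Finset.mul_sum]
    refine tendsto_finsetSum _ fun i _ => tendsto_finsetSum _ fun j _ => ?_
    exact (((h i j).mul_const (a.ofLp j)).const_mul (a.ofLp i)).congr fun k => by ring
  refine (h1.sqrt.const_mul z).congr fun k => ?_
  rw [Real.sqrt_mul (Nat.cast_nonneg _)]
  ring

theorem tendstoInProb_credible (a : EuclideanSpace ℝ (Fin p)) {z : ℝ} (hz : 0 < z) :
    TendstoInProb E.P₀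
      (fun n y => ∫ θ in E.Θ ∩ E.credibleSet n (m n) a z y, E.posterior n (m n) y θ)
      (normalMass (a.ofLp ⬝ᵥ J⁻¹ *ᵥ a.ofLp) (z * √(a.ofLp ⬝ᵥ J⁻¹ *ᵥ a.ofLp))) := by
  refine tendstoInProb_of_goodAt hgood _ _ fun K T ν y hg => ?_
  obtain ⟨S, hpos⟩ := R.laplaceSetting hδ hg
  exact S.tendsto_credible (Experiment.eventually_posterior_eq hpos) a hz _
    (R.tendsto_posteriorCov hδ hg)

end Regular
end BSL

/-! ### Slutsky's theorem on varying probability spaces, and coverage. -/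

namespace BSL

section Slutsky

variable {Ω : ℕ → Type*} [∀ n, MeasurableSpace (Ω n)] {μ : (n : ℕ) → Measure (Ω n)}
  [∀ n, IsProbabilityMeasure (μ n)] {F F' : Type*}
  [MeasurableSpace F] [MeasurableSpace F']

/-- Coordinates of the infinite product reproduce each law on one common space. -/
theorem map_eval_infinitePi {X : (n : ℕ) → Ω n → F} {n : ℕ} (hX : AEMeasurable (X n) (μ n)) :
    (Measure.infinitePi μ).map (fun ω => X n (ω n)) = (μ n).map (X n) := by
  have h := measurePreserving_eval_infinitePi μ n
  have h1 : AEMeasurable (X n) ((Measure.infinitePi μ).map (Function.eval n)) := by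
    rwa [h.map_eq]
  have h2 := AEMeasurable.map_map_of_aemeasurable h1 h.measurable.aemeasurable
  rw [h.map_eq] at h2
  exact h2.symm

theorem aemeasurable_eval_infinitePi {X : (n : ℕ) → Ω n → F} {n : ℕ}
    (hX : AEMeasurable (X n) (μ n)) :
    AEMeasurable (fun ω : (n : ℕ) → Ω n => X n (ω n)) (Measure.infinitePi μ) :=
  hX.comp_quasiMeasurePreserving
    (measurePreserving_eval_infinitePi μ n).quasiMeasurePreserving

variable [NormedAddCommGroup F] [SecondCountableTopology F] [BorelSpace F]
  [NormedAddCommGroup F'] [SecondCountableTopology F'] [BorelSpace F']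

/-- **Slutsky's theorem** for random variables defined on varying probability spaces. -/
theorem tendstoInDistribution_slutsky {X : (n : ℕ) → Ω n → F} {Y : (n : ℕ) → Ω n → F'}
    {ξ : Measure F} [IsProbabilityMeasure ξ] {c : F'}
    (hX : TendstoInDistribution X atTop id μ ξ) (hY : TendstoInProb μ Y c)
    (hYm : ∀ n, AEMeasurable (Y n) (μ n)) {G : Type*} [NormedAddCommGroup G]
    [MeasurableSpace G] [BorelSpace G] {g : F × F' → G} (hg : Continuous g) {ξ' : Measure G}
    [IsProbabilityMeasure ξ'] (hξ' : ξ.map (fun x => g (x, c)) = ξ') :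
    TendstoInDistribution (fun n ω => g (X n ω, Y n ω)) atTop id μ ξ' := by
  -- The statement involves only the joint law of `X n` and `Y n` for each `n` separately, so the
  -- experiments may be coupled independently and Slutsky's theorem applied on the product space.
  have hXm := hX.forall_aemeasurable
  have hX' : TendstoInDistribution (fun n (ω : (n : ℕ) → Ω n) => X n (ω n)) atTop id
      (fun _ => Measure.infinitePi μ) ξ := by
    refine ⟨fun n => aemeasurable_eval_infinitePi (hXm n), aemeasurable_id, ?_⟩
    refine hX.tendsto.congr fun n => ?_
    exact Subtype.ext (map_eval_infinitePi (hXm n)).symm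
  have hY' : TendstoInMeasure (Measure.infinitePi μ) (fun n (ω : (n : ℕ) → Ω n) => Y n (ω n)) atTop
      (fun _ => c) := by
    rw [tendstoInMeasure_iff_dist]
    intro ε hε
    refine (hY ε hε).congr fun n => ?_
    have hs : NullMeasurableSet {ω | ε ≤ dist (Y n ω) c} (μ n) := by
      have h1 : AEMeasurable (fun ω => dist (Y n ω) c) (μ n) := by
        have h2 : Measurable fun v : F' => dist v c := (by fun_prop : Continuous fun v : F' => dist v c).measurable
        exact h2.comp_aemeasurable (hYm n)
      exact nullMeasurableSet_le aemeasurable_const h1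
    exact ((measurePreserving_eval_infinitePi μ n).measure_preimage hs).symm
  have h := hX'.continuous_comp_prodMk_of_tendstoInMeasure_const hg hY'
    (fun n => aemeasurable_eval_infinitePi (hYm n))
  have hm : ∀ n, AEMeasurable (fun ω => g (X n ω, Y n ω)) (μ n) := fun n =>
    hg.measurable.comp_aemeasurable ((hXm n).prodMk (hYm n))
  refine ⟨hm, aemeasurable_id, ?_⟩
  have h1 := h.tendsto
  have h2 : (⟨ξ'.map id, Measure.isProbabilityMeasure_map aemeasurable_id⟩ : ProbabilityMeasure G) =
      ⟨ξ.map (fun x => g (id x, c)), Measure.isProbabilityMeasure_map h.aemeasurable_limit⟩ :=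
    Subtype.ext (by simp [hξ'])
  rw [h2]
  refine h1.congr fun n => Subtype.ext ?_
  exact map_eval_infinitePi (X := fun n ω => g (X n ω, Y n ω)) (hm n)

end Slutsky

theorem posSemidef_scoreCov {p d : ℕ} {b : EuclideanSpace ℝ (Fin p) → EuclideanSpace ℝ (Fin d)}
    {Sig : EuclideanSpace ℝ (Fin p) → Matrix (Fin d) (Fin d) ℝ} {V : Matrix (Fin d) (Fin d) ℝ}
    {θ : EuclideanSpace ℝ (Fin p)} (hV : V.PosSemidef) (hSig : (Sig θ).PosDef) :
    (scoreCov b Sig V θ).PosSemidef := by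
  have h := hV.conjTranspose_mul_mul_same ((Sig θ)⁻¹ * jacobian b θ)
  have hs : ((Sig θ)⁻¹)ᵀ = (Sig θ)⁻¹ := by simpa using hSig.inv.1.eq
  rw [Matrix.conjTranspose_eq_transpose_of_trivial, Matrix.transpose_mul, hs] at h
  simpa [scoreCov, Matrix.mul_assoc] using h

theorem normalMass_zero_zero : normalMass 0 0 = 1 := by
  simp [normalMass, measureReal_def]

/-- Variance zero is included because the sandwich matrix may be degenerate; then `0 < r` keeps the
point mass off the boundary. -/
theorem gaussianReal_abs_eq_null (v : NNReal) {r : ℝ} (hr : 0 < r) :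
    gaussianReal 0 v {x | |x| = r} = 0 := by
  have hsub : {x : ℝ | |x| = r} ⊆ {r, -r} := fun x hx => by
    rcases (abs_eq hr.le).1 hx with h | h <;> simp [h]
  rcases eq_or_ne v 0 with rfl | hv
  · rw [gaussianReal_zero_var, Measure.dirac_apply' _ (measurableSet_eq_fun (by fun_prop) (by fun_prop))]
    simp [hr.ne]
  · have := nullSingletonClass_gaussianReal (μ := 0) hv
    exact measure_mono_null hsub ((Set.toFinite _).measure_zero _)

/-- Coverage of an interval with random half-length. -/
theorem tendsto_coverage {Ω : ℕ → Type*} [∀ n, MeasurableSpace (Ω n)]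
    {μ : (n : ℕ) → Measure (Ω n)} [∀ n, IsProbabilityMeasure (μ n)] {p : ℕ}
    {U : (n : ℕ) → Ω n → EuclideanSpace ℝ (Fin p)} {R : (n : ℕ) → Ω n → ℝ}
    {A : Matrix (Fin p) (Fin p) ℝ} (hA : A.PosSemidef) {r : ℝ} (hr : 0 < r)
    (hU : TendstoInDistribution U atTop id μ (multivariateGaussian 0 A))
    (hR : TendstoInProb μ R r) (hRm : ∀ n, AEMeasurable (R n) (μ n))
    (a : EuclideanSpace ℝ (Fin p)) :
    Tendsto (fun n => (μ n).real {ω | |a.ofLp ⬝ᵥ (U n ω).ofLp| ≤ R n ω}) atTop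
      (𝓝 (normalMass (a.ofLp ⬝ᵥ A *ᵥ a.ofLp) r)) := by
  have hcont : Continuous fun u : EuclideanSpace ℝ (Fin p) => a.ofLp ⬝ᵥ u.ofLp := by
    unfold dotProduct; fun_prop
  -- Coverage is the event `g ≤ 0`, with `g` continuous in the pair. Slutsky's theorem and the
  -- portmanteau theorem apply, since the limit law does not charge the boundary `{0}`.
  set g : EuclideanSpace ℝ (Fin p) × ℝ → ℝ := fun x => |a.ofLp ⬝ᵥ x.1.ofLp| - x.2 with hg
  have hgc : Continuous g := (hcont.comp continuous_fst).abs.sub continuous_snd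
  set ξ := (multivariateGaussian (0 : EuclideanSpace ℝ (Fin p)) A).map (fun x => g (x, r)) with hξ
  have hgm : Measurable fun x : EuclideanSpace ℝ (Fin p) => g (x, r) :=
    (hgc.comp (by fun_prop : Continuous fun x : EuclideanSpace ℝ (Fin p) => (x, r))).measurable
  have : IsProbabilityMeasure ξ := Measure.isProbabilityMeasure_map hgm.aemeasurable
  have h := tendstoInDistribution_slutsky hU hR hRm hgc hξ.symm
  have hmap := map_dotProduct_multivariateGaussian hA a
  have hnull : ξ (frontier (Iic 0)) = 0 := by
    rw [frontier_Iic, hξ, Measure.map_apply hgm (measurableSet_singleton _)]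
    have h1 := gaussianReal_abs_eq_null (a.ofLp ⬝ᵥ A *ᵥ a.ofLp).toNNReal hr
    rw [← hmap, Measure.map_apply hcont.measurable
      (measurableSet_eq_fun (by fun_prop) (by fun_prop))] at h1
    convert h1 using 2
    ext u
    simp [hg, sub_eq_zero]
  have hlim := ProbabilityMeasure.tendsto_measure_of_null_frontier_of_tendsto' h.tendsto
    (E := Iic (0 : ℝ)) (by simpa using hnull)
  have hlim' := (ENNReal.tendsto_toReal (by simp)).comp hlim
  simp only [ProbabilityMeasure.coe_mk, Measure.map_id] at hlim'
  have hval : (ξ (Iic 0)).toReal = normalMass (a.ofLp ⬝ᵥ A *ᵥ a.ofLp) r := by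
    rw [normalMass, ← hmap, measureReal_def, hξ, Measure.map_apply hgm measurableSet_Iic,
      Measure.map_apply hcont.measurable measurableSet_Icc]
    congr 2
    ext u
    simp [hg, abs_le]
  rw [hval] at hlim'
  refine hlim'.congr fun n => ?_
  simp only [Function.comp_apply]
  rw [Measure.map_apply_of_aemeasurable (h.forall_aemeasurable n) measurableSet_Iic,
    measureReal_def]
  congr 2
  ext ω
  simp [hg]

end BSL

/-! ### Assembly of the main theorem. -/

theorem mainTheorem4 {p d : ℕ} (E : BSL.Experiment p d)
    (m : ℕ → ℕ) (hm : Tendsto m atTop atTop)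
    (b : EuclideanSpace ℝ (Fin p) → EuclideanSpace ℝ (Fin d))
    (b₀ : EuclideanSpace ℝ (Fin d)) (V : Matrix (Fin d) (Fin d) ℝ)
    (Sig : EuclideanSpace ℝ (Fin p) → Matrix (Fin d) (Fin d) ℝ)
    (M : EuclideanSpace ℝ (Fin p) → EuclideanSpace ℝ (Fin p))
    (H : EuclideanSpace ℝ (Fin p) → Matrix (Fin p) (Fin p) ℝ)
    (θs : EuclideanSpace ℝ (Fin p))
    -- compactness of the parameter space; smoothness of the log synthetic likelihood
    (hΘ : IsCompact E.Θ)
    (hsmooth : ∀ᶠ n in atTop, ∀ s : EuclideanSpace ℝ (Fin d),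
      ContDiffOn ℝ 2 (fun θ => Real.log (E.exactSL n s θ)) (interior E.Θ))
    -- the model mean of the summaries is `b` (up to a uniformly vanishing `n`-dependence)
    (hb : TendstoUniformlyOn (fun n θ => E.mean n θ) b atTop E.Θ)
    (hb_cont : ContinuousOn b E.Θ)
    (hb_diff : DifferentiableAt ℝ b θs)
    -- consistency and asymptotic normality of the observed summaries
    (hS : BSL.TendstoInProb E.P₀ (fun n y => E.S n y) b₀)
    (hV : V.PosSemidef)
    (hSclt : TendstoInDistribution (fun (n : ℕ) y => Real.sqrt n • (E.S n y - b₀)) atTop id E.P₀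
      (multivariateGaussian 0 V))
    -- `M` and `H` are the probability limits of the score and of the Hessian
    (hM : ∀ θ ∈ interior E.Θ, BSL.TendstoInProb E.P₀ (E.score · θ) (M θ))
    (hH : ∀ θ ∈ interior E.Θ, ∀ i j,
      BSL.TendstoInProb E.P₀ (fun n y => E.hess n θ y i j) (H θ i j))
    -- `θs` is the only root, with `-H θs` positive definite
    (hroot : E.roots M = {θs})
    (hHpos : (-H θs).PosDef)
    -- the limit criterion is maximized over `Θ` only at interior roots
    (hmax : ∀ θ ∈ E.Θ, IsMaxOn (BSL.limitCriterion b Sig b₀) E.Θ θ → θ ∈ E.roots M)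
    -- Lipschitz Hessian at `θs`, with a constant bounded in probability
    (hLip : ∃ δ : ℝ, 0 < δ ∧ ∀ η : ℝ, 0 < η → ∃ K : ℝ, ∀ᶠ n in atTop,
      E.P₀ n {y | ¬ ∀ θ ∈ interior E.Θ, dist θ θs ≤ δ → ∀ i j,
        |E.hess n θ y i j - E.hess n θs y i j| ≤ K * dist θ θs} ≤ ENNReal.ofReal η)
    -- `n Σₙ → Σ` uniformly, with `Σ` continuous and positive definite
    (hSig_cont : ContinuousOn Sig E.Θ)
    (hSig_pos : ∀ θ ∈ E.Θ, (Sig θ).PosDef)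
    (hSig : ∀ i j, TendstoUniformlyOn (fun (n : ℕ) θ => (n : ℝ) * E.covMat n θ i j)
      (fun θ => Sig θ i j) atTop E.Θ)
    -- the prior density is positive at `θs` and continuous near `θs`
    (hprior_pos : 0 < E.prior θs)
    (hprior_cont : ∃ δ : ℝ, 0 < δ ∧ ContinuousOn E.prior (Metric.closedBall θs δ ∩ E.Θ))
    -- the estimated synthetic likelihood is asymptotically unbiased, in relative error
    (hest : ∀ ε : ℝ, 0 < ε → Tendsto (fun n => E.P₀ n {y | ¬ ∀ θ ∈ E.Θ,
      |E.estSL n (m n) (E.S n y) θ - E.exactSL n (E.S n y) θ|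
        ≤ ε * E.exactSL n (E.S n y) θ}) atTop (𝓝 0))
    -- asymptotic normality of the score at `θs`
    (hscore : TendstoInDistribution (fun (n : ℕ) y => Real.sqrt n • E.score n θs y) atTop id E.P₀
      (multivariateGaussian 0 (BSL.scoreCov b Sig V θs)))
    (Δ A : Matrix (Fin p) (Fin p) ℝ) (hΔ : Δ = (-H θs)⁻¹)
    (hA : A = Δ * BSL.scoreCov b Sig V θs * Δᵀ) :
    -- asymptotic law of the posterior mean
    TendstoInDistribution (fun (n : ℕ) y => Real.sqrt n • (E.posteriorMean n (m n) y - θs)) atTop id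
      E.P₀ (multivariateGaussian 0 A) ∧
    -- the rescaled posterior covariance converges to `Δ`
    (∀ i j, BSL.TendstoInProb E.P₀
      (fun (n : ℕ) y => (n : ℝ) * E.posteriorCov n (m n) y i j) (Δ i j)) ∧
    -- limits of posterior probability and of frequentist coverage of credible sets
    (∀ (a : EuclideanSpace ℝ (Fin p)) (z : ℝ), 0 < z →
      BSL.TendstoInProb E.P₀
        (fun n y => ∫ θ in E.Θ ∩ E.credibleSet n (m n) a z y, E.posterior n (m n) y θ)
        (BSL.normalMass (a.ofLp ⬝ᵥ Δ *ᵥ a.ofLp) (z * Real.sqrt (a.ofLp ⬝ᵥ Δ *ᵥ a.ofLp))) ∧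
      Tendsto (fun n => (E.P₀ n).real {y | θs ∈ E.credibleSet n (m n) a z y}) atTop
        (𝓝 (BSL.normalMass (a.ofLp ⬝ᵥ A *ᵥ a.ofLp)
          (z * Real.sqrt (a.ofLp ⬝ᵥ Δ *ᵥ a.ofLp))))) ∧
    -- if the two variances differ, some credible sets do not have their nominal coverage
    (A ≠ Δ → ∃ a : EuclideanSpace ℝ (Fin p), ∀ z : ℝ, 0 < z →
      BSL.normalMass (a.ofLp ⬝ᵥ A *ᵥ a.ofLp) (z * Real.sqrt (a.ofLp ⬝ᵥ Δ *ᵥ a.ofLp)) ≠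
        BSL.normalMass (a.ofLp ⬝ᵥ Δ *ᵥ a.ofLp) (z * Real.sqrt (a.ofLp ⬝ᵥ Δ *ᵥ a.ofLp))) := by
  subst hΔ
  have hθs : θs ∈ E.roots M := hroot ▸ mem_singleton θs
  have hθi : θs ∈ interior E.Θ := hθs.1
  have hθΘ : θs ∈ E.Θ := interior_subset hθi
  obtain ⟨δ, hδ, hLip⟩ := hLip
  set J : Matrix (Fin p) (Fin p) ℝ := -H θs with hJ
  set W := BSL.scoreCov b Sig V θs
  have hW : W.PosSemidef := BSL.posSemidef_scoreCov hV (hSig_pos θs hθΘ)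
  have hApsd : A.PosSemidef := by
    rw [hA]
    simpa using hW.mul_mul_conjTranspose_same J⁻¹
  have hΔpos : (J⁻¹).PosDef := hHpos.inv
  have R : BSL.Regular E b b₀ Sig J θs :=
    { compact := hΘ
      smooth := hsmooth
      mean := hb
      continuousOn_mean := hb_cont
      cov := hSig
      continuousOn_cov := hSig_cont
      posDef_cov := hSig_pos
      mem_interior := hθi
      posDef := hHpos
      unique_max := fun θ hθ hm => by
        have h := hmax θ hθ hm
        rw [hroot] at h
        exact h
      prior_pos := hprior_pos
      continuousAt_prior := by
        obtain ⟨δ', hδ', hc⟩ := hprior_cont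
        exact hc.continuousAt (inter_mem (Metric.closedBall_mem_nhds θs hδ')
          (mem_interior_iff_mem_nhds.1 hθi)) }
  have hgood : ∀ η, 0 < η → ∃ K T : ℝ, ∀ ε, 0 < ε → ∀ᶠ n in atTop,
      E.P₀ n {y | ¬ BSL.GoodAt E m b₀ J θs δ K T ε n y} ≤ ENNReal.ofReal η := fun η hη =>
    BSL.exists_goodAt hS (fun i j => by simpa [hJ] using hH θs hθi i j) hLip hest hscore hη
  have hmeanm : ∀ n : ℕ, Measurable fun y => √(n : ℝ) • (E.posteriorMean n (m n) y - θs) :=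
    fun n => ((E.measurable_posteriorMean n (m n)).sub_const θs).const_smul (√(n : ℝ))
  have hU : TendstoInDistribution
      (fun (n : ℕ) y => √(n : ℝ) • (E.posteriorMean n (m n) y - θs)) atTop id
      E.P₀ (multivariateGaussian 0 A) := by
    have hlaw : (multivariateGaussian (0 : EuclideanSpace ℝ (Fin p)) W).map
        (fun x => Matrix.toEuclideanCLM (𝕜 := ℝ) J⁻¹ x + (0 : EuclideanSpace ℝ (Fin p))) =
        multivariateGaussian 0 A := by
      simp only [add_zero]
      rw [hA]
      exact BSL.map_toEuclideanCLM_multivariateGaussian hW J⁻¹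
    -- The posterior mean is written as the linear image of the score plus a remainder tending to
    -- zero in probability.
    have h := BSL.tendstoInDistribution_slutsky
      (g := fun x => Matrix.toEuclideanCLM (𝕜 := ℝ) J⁻¹ x.1 + x.2) hscore
      (R.tendstoInProb_posteriorMean hδ hgood)
      (fun n => (hmeanm n).aemeasurable.sub
        ((Matrix.toEuclideanCLM (𝕜 := ℝ) J⁻¹).continuous.measurable.comp_aemeasurable
          (hscore.forall_aemeasurable n))) (by fun_prop) hlaw
    simpa using h
  refine ⟨hU, fun i j => R.tendstoInProb_posteriorCov hδ hgood i j, fun a z hz =>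
    ⟨R.tendstoInProb_credible hδ hgood a hz, ?_⟩, fun hne => ?_⟩
  -- For `a = 0` the limit half-width vanishes and the null-boundary argument fails, but the
  -- credible set is everything and both sides equal one.
  · rcases eq_or_ne a 0 with rfl | ha
    · simp [BSL.Experiment.credibleSet, BSL.normalMass_zero_zero]
    have haΔ : 0 < a.ofLp ⬝ᵥ J⁻¹ *ᵥ a.ofLp := by
      simpa using hΔpos.dotProduct_mulVec_pos (x := a.ofLp) (by simpa using ha)
    have h := BSL.tendsto_coverage hApsd (r := z * √(a.ofLp ⬝ᵥ J⁻¹ *ᵥ a.ofLp)) (by positivity) hU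
      (R.tendstoInProb_posteriorStd hδ hgood a z) (fun n => by
        have hc := E.measurable_posteriorCov n (m n)
        simp only [dotProduct, Matrix.mulVec]
        fun_prop) a
    refine h.congr' ?_
    filter_upwards [eventually_gt_atTop 0] with n hn
    have hn' : 0 < √(n : ℝ) := Real.sqrt_pos.2 (by exact_mod_cast hn)
    congr 1
    ext y
    show |a.ofLp ⬝ᵥ (√(n : ℝ) • (E.posteriorMean n (m n) y - θs)).ofLp| ≤ _ ↔
      |a.ofLp ⬝ᵥ (θs - E.posteriorMean n (m n) y).ofLp| ≤ _
    rw [WithLp.ofLp_smul, dotProduct_smul, smul_eq_mul, abs_mul, abs_of_pos hn',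
      mul_le_mul_iff_right₀ hn', ← neg_sub, WithLp.ofLp_neg, dotProduct_neg, abs_neg]
  -- Distinct symmetric matrices differ in some direction `a`, necessarily nonzero. There the
  -- nominal variance is positive, so the half-width is positive for every `z`, even if the sandwich
  -- variance is zero.
  · obtain ⟨a, ha⟩ := BSL.exists_quad_ne (by simpa using hApsd.1.eq) (by simpa using hΔpos.1.eq) hne
    have ha0 : a ≠ 0 := by
      rintro rfl
      simp [BSL.quad] at ha
    have haΔ : 0 < a.ofLp ⬝ᵥ J⁻¹ *ᵥ a.ofLp := by
      simpa using hΔpos.dotProduct_mulVec_pos (x := a.ofLp) (by simpa using ha0)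
    refine ⟨a, fun z hz => BSL.normalMass_ne ?_ haΔ.le ha (by positivity)⟩
    simpa using hApsd.dotProduct_mulVec_nonneg a.ofLp
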